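/- Let $K=\mathbb C(x_1,\dots,x_n)$ with the derivations $\partial/\partial x_1,\dots,\partial/\partial x_n$. A differential extension $L$ of $K$ is a field extension $L\supseteq K$ with commuting derivations $\partial_1,\dots,\partial_n$ of $L$ that extend $\partial/\partial x_1,\dots,\partial/\partial x_n$; for $f\in L$ put $df=\sum_{i}\partial_i(f)\,dx_i$. It is called elementary if $L$ and $K$ have the same constants and there is a finite tower of fields $K=K_0\subseteq K_1\subseteq\dots\subseteq K_N=L$ such that for each $i<N$ one of the following holds: (i) $K_{i+1}=K_i(t)$ with $t\neq 0$ and $dt/t=dR$ for some $R\in K_i$; (ii) $K_{i+1}=K_i(t)$ with $dt=dR/R$ for some $R\in K_i$, $R\ne0$; (iii) $K_{i+1}$ is a finite algebraic extension of $K_i$. Let $\Omega=\sum_{i=1}^n P_i\,dx_1\wedge\cdots\wedge\widehat{dx_i}\wedge\cdots\wedge dx_n$ be an $(n-1)$-form with $P_1,\dots,P_n\in K$. Suppose there are an elementary extension $L$ of $K$, an integer $M\ge 0$, $c_1,\dots,c_M\in\mathbb C$, $u_1,\dots,u_M\in L\setminus\{0\}$ and $v\in L$ such that $$\Big(\sum_{i=1}^M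 c_i\frac{du_i}{u_i}+dv\Big)\wedge\Omega=0,\qquad \sum_{i=1}^M c_i\frac{du_i}{u_i}+dv\neq 0.$$ Then there are a finite algebraic extension $\widetilde L$ of $K$ with $\widetilde L\subseteq L$, an integer $\widetilde M\ge 0$, $\widetilde c_1,\dots,\widetilde c_{\widetilde M}\in\mathbb C$, $\widetilde u_1,\dots,\widetilde u_{\widetilde M}\in\widetilde L\setminus\{0\}$ and $\widetilde v\in\widetilde L$ such that $$\Big(\sum_{i=1}^{\widetilde M} \widetilde c_i\frac{d\widetilde u_i}{\widetilde u_i}+d\widetilde v\Big)\wedge\Omega=0,\qquad \sum_{i=1}^{\widetilde M} \widetilde c_i\frac{d\widetilde u_i}{\widetilde u_i}+d\widetilde v\neq 0.$$ -/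

import Mathlib

/-! Differential extensions of the field of rational functions in `n` variables over `ℂ`,
elementary extensions, one-forms and `(n-1)`-forms. -/

/-- The rational function field `ℂ(x₁, …, xₙ)`. -/
abbrev RatFunField (n : ℕ) : Type := FractionRing (MvPolynomial (Fin n) ℂ)

namespace RatFunField

variable {n : ℕ}

/-- The `ℂ`-algebra homomorphism `p ↦ p + (∂p/∂xᵢ) ε` from polynomials to dual numbers over the
rational function field. -/
noncomputable def polyToDual (i : Fin n) :
    MvPolynomial (Fin n) ℂ →ₐ[ℂ] TrivSqZeroExt (RatFunField n) (RatFunField n) where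
  toFun p := TrivSqZeroExt.inl (algebraMap _ (RatFunField n) p) +
    TrivSqZeroExt.inr (algebraMap _ (RatFunField n) (MvPolynomial.pderiv i p))
  map_one' := by ext <;> simp
  map_mul' p q := by
    ext
    · simp
    · simp only [Derivation.leibniz, smul_eq_mul, map_mul, map_add, TrivSqZeroExt.snd_mul,
        TrivSqZeroExt.snd_add, TrivSqZeroExt.fst_add, TrivSqZeroExt.snd_inl,
        TrivSqZeroExt.snd_inr, TrivSqZeroExt.fst_inl, TrivSqZeroExt.fst_inr, zero_add, add_zero,
        MulOpposite.smul_eq_mul_unop, MulOpposite.unop_op]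
      ring
  map_zero' := by ext <;> simp
  map_add' p q := by ext <;> simp [Algebra.smul_def]
  commutes' c := by
    rw [TrivSqZeroExt.algebraMap_eq_inl']
    ext
    · simp [IsScalarTower.algebraMap_apply ℂ (MvPolynomial (Fin n) ℂ) (RatFunField n)]
    · simp

theorem isUnit_polyToDual (i : Fin n) (y : nonZeroDivisors (MvPolynomial (Fin n) ℂ)) :
    IsUnit (polyToDual i y) := by
  rw [TrivSqZeroExt.isUnit_iff_isUnit_fst]
  simp [polyToDual]

/-- The homomorphism `a ↦ a + (∂a/∂xᵢ) ε` on rational functions. -/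
noncomputable def toDual (i : Fin n) :
    RatFunField n →ₐ[ℂ] TrivSqZeroExt (RatFunField n) (RatFunField n) :=
  IsLocalization.liftAlgHom (M := nonZeroDivisors (MvPolynomial (Fin n) ℂ))
    (f := polyToDual i) (isUnit_polyToDual i)

theorem toDual_algebraMap (i : Fin n) (p : MvPolynomial (Fin n) ℂ) :
    toDual i (algebraMap _ (RatFunField n) p) = polyToDual i p :=
  IsLocalization.lift_eq _ _

theorem fst_toDual (i : Fin n) (a : RatFunField n) : (toDual i a).fst = a := by
  have h : (TrivSqZeroExt.fstHom ℂ (RatFunField n) (RatFunField n)).comp (toDual i) =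
      AlgHom.id ℂ (RatFunField n) := by
    refine IsLocalization.algHom_ext (nonZeroDivisors (MvPolynomial (Fin n) ℂ)) ?_
    refine AlgHom.ext fun p => ?_
    change (toDual i (algebraMap _ (RatFunField n) p)).fst = algebraMap _ (RatFunField n) p
    rw [toDual_algebraMap]
    simp [polyToDual]
  exact congrArg (fun f => f a) h

/-- The partial derivative `∂/∂xᵢ` of rational functions. -/
noncomputable def partialDeriv (i : Fin n) : Derivation ℂ (RatFunField n) (RatFunField n) :=
  Derivation.mk'
    ((TrivSqZeroExt.sndHom (RatFunField n) (RatFunField n)).restrictScalars ℂ ∘ₗ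
      (toDual i).toLinearMap)
    (fun a b => by simp [fst_toDual, mul_comm])

/-- On polynomials `partialDeriv` is the usual partial derivative. -/
theorem partialDeriv_algebraMap (i : Fin n) (p : MvPolynomial (Fin n) ℂ) :
    partialDeriv i (algebraMap _ (RatFunField n) p) =
      algebraMap _ (RatFunField n) (MvPolynomial.pderiv i p) := by
  change (toDual i (algebraMap _ (RatFunField n) p)).snd = _
  rw [toDual_algebraMap]
  exact (TrivSqZeroExt.snd_add _ _).trans (zero_add _)

end RatFunField

section Extensions

variable {n : ℕ} {L : Type*} [Field L]

/-- The constants of a ring with derivations `D 0, …, D (n-1)`. -/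
def diffConstants {R A : Type*} [CommRing R] [CommRing A] [Algebra R A]
    (D : Fin n → Derivation R A A) : Set A := {a | ∀ i, D i a = 0}

/-- The differential of `f`, as the one-form `∑ᵢ (D i f) dxᵢ`. The one-form `∑ᵢ aᵢ dxᵢ` with
coefficients in `L` is represented by the tuple `a : Fin n → L`. -/
def dform (D : Fin n → Derivation ℤ L L) (f : L) : Fin n → L := fun i => D i f

variable [Algebra (RatFunField n) L]

/-- `L`, with the commuting derivations `D i`, is a differential extension of `ℂ(x₁, …, xₙ)`
with the derivations `∂/∂xᵢ`. -/
structure IsDifferentialExtension (D : Fin n → Derivation ℤ L L) : Prop where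
  comm : ∀ i j a, D i (D j a) = D j (D i a)
  restrict : ∀ i (a : RatFunField n),
    D i (algebraMap (RatFunField n) L a) =
      algebraMap (RatFunField n) L (RatFunField.partialDeriv i a)

/-- One step `E ⊆ F` of an elementary tower: `F = E(t)` for an exponential `t`, i.e.
`dt / t = dR` with `R ∈ E`; or `F = E(t)` for a logarithm `t`, i.e. `dt = dR / R` with `R ∈ E`;
or `F` is a finite algebraic extension of `E`. -/
def IsElementaryStep (D : Fin n → Derivation ℤ L L)
    (E F : IntermediateField (RatFunField n) L) : Prop :=
  (∃ t R : L, t ≠ 0 ∧ R ∈ E ∧ t⁻¹ • dform D t = dform D R ∧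
    F = (IntermediateField.adjoin E {t}).restrictScalars (RatFunField n)) ∨
  (∃ t R : L, R ≠ 0 ∧ R ∈ E ∧ dform D t = R⁻¹ • dform D R ∧
    F = (IntermediateField.adjoin E {t}).restrictScalars (RatFunField n)) ∨
  (∃ h : E ≤ F, FiniteDimensional E (IntermediateField.extendScalars h))

/-- `L` is an elementary extension of `K = ℂ(x₁, …, xₙ)`: a differential extension with the same
constants that is reached from `K` by a finite tower of elementary steps. -/
structure IsElementaryExtension (D : Fin n → Derivation ℤ L L) : Prop
    extends IsDifferentialExtension D where
  constants_eq : diffConstants D =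
    algebraMap (RatFunField n) L '' diffConstants (RatFunField.partialDeriv (n := n))
  tower : Relation.ReflTransGen (IsElementaryStep D) ⊥ ⊤

end Extensions

section Forms

variable {n : ℕ} (L : Type*) [Field L] [Algebra (RatFunField n) L]

/-- The `(n-1)`-form `∑ᵢ Pᵢ dx₁ ∧ ⋯ ∧ dxᵢ₋₁ ∧ dxᵢ₊₁ ∧ ⋯ ∧ dxₙ` with coefficients `Pᵢ` in
`ℂ(x₁, …, xₙ)`, regarded as a form over `L`: an element of the exterior algebra of the space
of one-forms over `L`, whose basis vector `Pi.single j 1` is `dxⱼ`. -/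
noncomputable def nSubOneForm (P : Fin n → RatFunField n) : ExteriorAlgebra L (Fin n → L) :=
  ∑ i, algebraMap (RatFunField n) L (P i) •
    (((List.finRange n).filter (fun j => j ≠ i)).map
      (fun j => ExteriorAlgebra.ι L (Pi.single j (1 : L)))).prod

variable {L}

/-- The one-form `∑ₖ cₖ duₖ / uₖ + dv`. -/
noncomputable def logForm (D : Fin n → Derivation ℤ L L) {M : ℕ}
    (c : Fin M → ℂ) (u : Fin M → L) (v : L) : Fin n → L :=
  ∑ k, algebraMap (RatFunField n) L (algebraMap ℂ (RatFunField n) (c k)) •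
    ((u k)⁻¹ • dform D (u k)) + dform D v

/-- With `uₖ ≠ 0`: `(∑ₖ cₖ duₖ / uₖ + dv) ∧ Ω = 0` and `∑ₖ cₖ duₖ / uₖ + dv ≠ 0`,
where `Ω` is the `(n-1)`-form with coefficients `P`. -/
def IsElementaryRelation (D : Fin n → Derivation ℤ L L) (P : Fin n → RatFunField n) {M : ℕ}
    (c : Fin M → ℂ) (u : Fin M → L) (v : L) : Prop :=
  (∀ k, u k ≠ 0) ∧
  ExteriorAlgebra.ι L (logForm D c u v) * nSubOneForm L P = 0 ∧
  logForm D c u v ≠ 0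

end Forms

/-! Write `K` for the rational function field. Wedging a one-form with `Ω` amounts to evaluating it
on a vector field `X = ∑ sᵢ Dᵢ` with `sᵢ ∈ K` (`exists_contraction`). The hypothesis is thus a
nonzero closed form `ω = ∑ cₖ duₖ/uₖ + dv` with `ω(X) = 0`, and such a form is pushed down the tower
one step at a time, each field being replaced by its algebraic closure in `L` so that algebraic
steps cost nothing (`HasRelation.descend`).

The essential step has `k` algebraically closed in `L`, `t` transcendental over `k` with `dt/t = dR`
or `dt = dR/R`, `R ∈ k`, and `ω` over the algebraic closure of `k(t)`. Suppose that no such form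
exists over `k`. (a) Every `X`-constant `h` algebraic over `k(t)` lies in `k`. Otherwise `t` is
algebraic over `k(h)`. Norms or traces down to `k(h)`, followed by specializing `h` to an integer,
give `b ∈ k` such that `db/b - m dR`, respectively `db - m dR/R`, is killed by `X`. By assumption
this form is zero, so `b/tᵐ`, respectively `b - m t`, is a constant of `L`, and `t` is algebraic
over `k` (`isAlgebraic_new_constant`). An `X`-constant `h ∈ k` is a complex number, for otherwise
`dh` would be a form over `k` killed by `X`. (b) Let `δ` be the `k`-derivation `t d/dt`,
respectively `d/dt`. It commutes with `X`, and `ω` is closed, so `X(ω(δ)) = δ(ω(X)) = 0` and `ω(δ) =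
γ ∈ ℂ`. (c) The form `ω - γ dt/t`, respectively `ω - γ dt`, is killed by `δ`, so by a residue
argument in the style of Liouville it is a form over `k` (`exists_logSum_eq_of_logSum_eq_zero`).
Adding back `γ dR`, respectively `γ dR/R`, exhibits `ω` itself as a form over `k`, a contradiction.
-/

/-! ### Extending and restricting derivations -/

section DerivationExtension

open TensorProduct in
-- For formally étale `S → T` the Kähler differentials of `T` are the base change of those of `S`.
theorem Derivation.exists_extension_of_formallyEtale {R S T : Type*} [CommRing R] [CommRing S]
    [CommRing T] [Algebra R S] [Algebra R T] [Algebra S T] [IsScalarTower R S T]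
    [Algebra.FormallyEtale S T] (d : Derivation R S T) :
    ∃ d' : Derivation R T T, ∀ s, d' (algebraMap S T s) = d s := by
  let f : T ⊗[S] Ω[S⁄R] →ₗ[T] T := LinearMap.liftBaseChange T d.liftKaehlerDifferential
  refine ⟨(f ∘ₗ (KaehlerDifferential.tensorKaehlerEquivOfFormallyEtale
    R S T).symm.toLinearMap).compDer (KaehlerDifferential.D R T), fun s => ?_⟩
  change f ((KaehlerDifferential.tensorKaehlerEquivOfFormallyEtale R S T).symm
    (KaehlerDifferential.D R T (algebraMap S T s))) = _
  rw [KaehlerDifferential.tensorKaehlerEquivOfFormallyEtale_symm_D_algebraMap]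
  simp [f]

/-- A derivation extends to any algebraic extension in characteristic zero. -/
theorem Differential.exists_extension_of_isAlgebraic (A B : Type*) [Field A] [Field B] [CharZero A]
    [Differential A] [Algebra A B] [Algebra.IsAlgebraic A B] :
    ∃ hB : Differential B, @DifferentialAlgebra A B _ _ _ _ hB := by
  have : Algebra.FormallyEtale A B := Algebra.FormallyEtale.of_isSeparable A B
  obtain ⟨d', h⟩ := Derivation.exists_extension_of_formallyEtale
    ((Algebra.linearMap A B).compDer (Differential.deriv : Derivation ℤ A A))
  exact ⟨⟨d'⟩, @DifferentialAlgebra.mk _ _ _ _ _ _ ⟨d'⟩ fun a => h a⟩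

open scoped IntermediateField.algebraAdjoinAdjoin in
/-- In characteristic zero, every transcendental element has derivative `1` with respect to some
derivation. -/
theorem Transcendental.exists_derivation_eq_one {k L : Type*} [Field k] [Field L] [CharZero k]
    [Algebra k L] {t : L} (ht : Transcendental k t) : ∃ δ : Derivation k L L, δ t = 1 := by
  classical
  have hi : AlgebraicIndepOn k id ({t} : Set L) := by
    have := (algebraicIndependent_unique_type_iff (R := k) (ι := ({t} : Set L))
      (x := fun i : ({t} : Set L) => (i : L))).2 ht
    exact this
  obtain ⟨s, hts, hs⟩ := exists_isTranscendenceBasis_superset hi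
  have hs' : AlgebraicIndependent k (Subtype.val : s → L) := hs.1
  have hmem : t ∈ s := hts rfl
  let S := Algebra.adjoin k (Set.range (Subtype.val : s → L))
  let Q := IntermediateField.adjoin k (Set.range (Subtype.val : s → L))
  have hSQ : Algebra.FormallyEtale S Q := .of_isLocalization (nonZeroDivisors _)
  have halg : Algebra.IsAlgebraic Q L := hs.isAlgebraic_field
  have hQL : Algebra.FormallyEtale Q L := Algebra.FormallyEtale.of_isSeparable Q L
  -- `L` is separable algebraic over the fraction field of the polynomial ring `S`, so the partial
  -- derivative in the variable `t` extends from `S` to `L`.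
  have hSL : Algebra.FormallyEtale S L := .comp S Q L
  let e : MvPolynomial s k ≃ₐ[k] S := hs'.aevalEquiv
  let d0 : Derivation k (MvPolynomial s k) (MvPolynomial s k) := MvPolynomial.pderiv ⟨t, hmem⟩
  let d : Derivation k S S := Derivation.mk'
    (e.toLinearMap ∘ₗ d0.toLinearMap ∘ₗ e.symm.toLinearMap) (fun a b => by simp [map_mul])
  obtain ⟨δ, hδ⟩ := Derivation.exists_extension_of_formallyEtale
    ((Algebra.linearMap S L).compDer d)
  refine ⟨δ, ?_⟩
  have h1 : algebraMap S L (e (MvPolynomial.X ⟨t, hmem⟩)) = t := by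
    exact (hs'.algebraMap_aevalEquiv _).trans (MvPolynomial.aeval_X _ _)
  have h2 := hδ (e (MvPolynomial.X ⟨t, hmem⟩))
  rw [h1] at h2
  rw [h2]
  change algebraMap S L (e (d0 (e.symm (e (MvPolynomial.X ⟨t, hmem⟩))))) = 1
  simp [d0]

/-- Differentiate the minimal polynomial of `x`, which is separable. -/
theorem Derivation.eq_zero_of_isAlgebraic {R A L : Type*} [CommRing R] [Field A] [Field L]
    [CharZero A] [Algebra A L] [Algebra R L] (d : Derivation R L L)
    (h : ∀ a, d (algebraMap A L a) = 0) {x : L} (hx : IsAlgebraic A x) : d x = 0 := by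
  let d' : Derivation A L L := Derivation.mk'
    { toFun := d
      map_add' := map_add d
      map_smul' := fun a x => by simp [Algebra.smul_def, h] } (fun a b => by simp)
  have h1 := d'.map_aeval (minpoly A x) x
  rw [minpoly.aeval, map_zero] at h1
  have hsep : (minpoly A x).Separable := (minpoly.irreducible hx.isIntegral).separable
  have := (mul_eq_zero.1 h1.symm).resolve_left
    (hsep.aeval_derivative_ne_zero (minpoly.aeval A x))
  exact this

/-- A derivation that preserves a subfield restricts to it. -/
theorem Differential.exists_of_forall_exists {A L : Type*} [Field A] [Field L] [Algebra A L]
    [Differential L]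
    (h : ∀ a, ∃ b, (Differential.deriv : Derivation ℤ L L) (algebraMap A L a) =
      algebraMap A L b) :
    ∃ hA : Differential A, @DifferentialAlgebra A L _ _ _ hA _ := by
  choose f hf using h
  have hinj := (algebraMap A L).injective
  let hA : Differential A := ⟨Derivation.mk' (AddMonoidHom.toIntLinearMap
    { toFun := f
      map_zero' := hinj (by simp [← hf])
      map_add' := fun a b => hinj (by simp [← hf]) })
    (fun a b => hinj (by
      change algebraMap A L (f (a * b)) = algebraMap A L (a * f b + b * f a)
      simp [← hf]))⟩
  exact ⟨hA, ⟨fun a => hf a⟩⟩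

/-- A derivation preserves a relative algebraic closure. -/
theorem Derivation.isAlgebraic_apply {A L : Type*} [Field A] [Field L]
    [CharZero A] [Algebra A L] (d : Derivation ℤ L L)
    (h : ∀ a, ∃ b, d (algebraMap A L a) = algebraMap A L b) {x : L} (hx : IsAlgebraic A x) :
    IsAlgebraic A (d x) := by
  let _ : Differential L := ⟨d⟩
  obtain ⟨_, _⟩ := Differential.exists_of_forall_exists h
  have h1 := Differential.deriv_aeval_eq x (minpoly A x)
  rw [minpoly.aeval, map_zero] at h1
  have hsep : (minpoly A x).Separable := (minpoly.irreducible hx.isIntegral).separable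
  have hne := hsep.aeval_derivative_ne_zero (minpoly.aeval A x)
  have h2 : d x = -Polynomial.aeval x (Differential.mapCoeffs (minpoly A x)) /
      Polynomial.aeval x (Polynomial.derivative (minpoly A x)) := by
    rw [eq_div_iff hne]
    change _ = _ + _ * d x at h1
    linear_combination -h1
  rw [h2, div_eq_mul_inv]
  have key : ∀ p : Polynomial A, IsAlgebraic A (Polynomial.aeval x p) := fun p =>
    (IsIntegral.of_mem_of_fg _ hx.isIntegral.fg_adjoin_singleton _
      (Polynomial.aeval_mem_adjoin_singleton A x)).isAlgebraic
  exact (key _).neg.mul (key _).inv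

end DerivationExtension

/-! ### Traces and norms of derivatives -/

section TraceNorm

variable {A B : Type*} [Field A] [Field B] [CharZero A] [Differential A] [Differential B]
  [Algebra A B] [DifferentialAlgebra A B] [FiniteDimensional A B]

open Differential

/-- The trace is the sum over the embeddings into an algebraic closure, and these commute with the
derivations because extensions to algebraic elements are unique. The norm is treated in the same way
as a product. -/
theorem Algebra.trace_deriv (y : B) : (Algebra.trace A B y)′ = Algebra.trace A B (y′) := by
  obtain ⟨_, _⟩ := Differential.exists_extension_of_isAlgebraic A (AlgebraicClosure A)
  apply (algebraMap A (AlgebraicClosure A)).injective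
  rw [← deriv_algebraMap, trace_eq_sum_embeddings (AlgebraicClosure A),
    trace_eq_sum_embeddings (AlgebraicClosure A), map_sum]
  refine Finset.sum_congr rfl fun σ _ => ?_
  exact (algHom_deriv σ σ.injective y (Algebra.IsSeparable.isSeparable A y)).symm

theorem Algebra.logDeriv_norm {y : B} (hy : y ≠ 0) :
    logDeriv (Algebra.norm A y) = Algebra.trace A B (logDeriv y) := by
  obtain ⟨_, _⟩ := Differential.exists_extension_of_isAlgebraic A (AlgebraicClosure A)
  apply (algebraMap A (AlgebraicClosure A)).injective
  rw [← logDeriv_algebraMap, Algebra.norm_eq_prod_embeddings A (AlgebraicClosure A),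
    trace_eq_sum_embeddings (AlgebraicClosure A), Differential.logDeriv_prod]
  · refine Finset.sum_congr rfl fun σ _ => ?_
    rw [Differential.logDeriv, Differential.logDeriv, map_div₀,
      algHom_deriv σ σ.injective y (Algebra.IsSeparable.isSeparable A y)]
  · intro σ _
    simpa using hy

end TraceNorm

/-! ### Residues at `w = 0` in `k(w)` -/

section Residue

open Polynomial

variable {k A : Type*} [Field k] [Field A] [Algebra k A]

/-- The rational expressions in `w` without pole at `w = 0`. -/
def regularAt (k : Type*) {A : Type*} [Field k] [Field A] [Algebra k A] (w : A) :
    Subalgebra k A where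
  carrier := {x | ∃ p q : k[X], q.eval 0 ≠ 0 ∧ x * aeval w q = aeval w p}
  mul_mem' := by
    rintro x y ⟨p, q, hq, h⟩ ⟨p', q', hq', h'⟩
    refine ⟨p * p', q * q', by simp [hq, hq'], ?_⟩
    rw [map_mul, map_mul, ← h, ← h']
    ring
  add_mem' := by
    rintro x y ⟨p, q, hq, h⟩ ⟨p', q', hq', h'⟩
    refine ⟨p * q' + p' * q, q * q', by simp [hq, hq'], ?_⟩
    rw [map_mul, map_add, map_mul, map_mul, ← h, ← h']
    ring
  algebraMap_mem' c := ⟨C c, 1, by simp, by simp⟩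

theorem self_mem_regularAt (w : A) : w ∈ regularAt k w :=
  ⟨X, 1, by simp, by simp⟩

theorem inv_notMem_regularAt {w : A} (hw : Transcendental k w) : w⁻¹ ∉ regularAt k w := by
  rintro ⟨p, q, hq, h⟩
  have hw0 : w ≠ 0 := by
    rintro rfl
    exact hw isAlgebraic_zero
  have h2 : aeval w q = aeval w (X * p) := by
    rw [map_mul, aeval_X, ← h]
    field_simp
  have h3 : q = X * p := (transcendental_iff_injective.1 hw) h2
  apply hq
  simp [h3]

theorem derivation_mem_regularAt {w : A} (d : Derivation k A A)
    (hd : d w = 1) {x : A} (hx : x ∈ regularAt k w) : d x ∈ regularAt k w := by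
  obtain ⟨p, q, hq, h⟩ := hx
  refine ⟨derivative p * q - p * derivative q, q * q, by simp [hq], ?_⟩
  have h1 := congrArg d h
  simp only [Derivation.leibniz, Derivation.map_aeval, hd, smul_eq_mul, mul_one] at h1
  simp only [map_mul, map_sub, ← h, ← h1]
  ring

theorem exists_zpow_mul_regularAt {w : A} (hw : Transcendental k w) {y : A} (hy : y ≠ 0)
    (hgen : ∃ p q : k[X], y = aeval w p / aeval w q) :
    ∃ (n : ℤ) (a : A), a ∈ regularAt k w ∧ a⁻¹ ∈ regularAt k w ∧ y = w ^ n * a := by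
  have hw0 : w ≠ 0 := by
    rintro rfl
    exact hw isAlgebraic_zero
  have hinj := transcendental_iff_injective.1 hw
  have key : ∀ p : k[X], p ≠ 0 → ∃ (n : ℕ) (p' : k[X]), p'.eval 0 ≠ 0 ∧
      aeval w p = w ^ n * aeval w p' := by
    intro p hp
    obtain ⟨p', h1, h2⟩ := exists_eq_pow_rootMultiplicity_mul_and_not_dvd p hp 0
    refine ⟨p.rootMultiplicity 0, p', fun h => h2 (dvd_iff_isRoot.2 h), ?_⟩
    conv_lhs => rw [h1]
    simp
  obtain ⟨p, q, rfl⟩ := hgen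
  obtain ⟨n, p', hp', hp⟩ := key p (by rintro rfl; simp at hy)
  obtain ⟨m, q', hq', hq⟩ := key q (by rintro rfl; simp at hy)
  have hne : ∀ r : k[X], r.eval 0 ≠ 0 → aeval w r ≠ 0 := by
    intro r hr h
    rw [← map_zero (aeval (R := k) w)] at h
    rw [hinj h] at hr
    simp at hr
  have hp0 := hne _ hp'
  have hq0 := hne _ hq'
  refine ⟨n - m, aeval w p' / aeval w q', ⟨p', q', hq', ?_⟩, ⟨q', p', hp', ?_⟩, ?_⟩
  · field_simp
  · field_simp
  · rw [hp, hq, zpow_sub₀ hw0, zpow_natCast, zpow_natCast]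
    field_simp

theorem zpow_notMem_regularAt {w : A} (hw : Transcendental k w) {n : ℤ} (hn : n < 0) :
    w ^ n ∉ regularAt k w := by
  have hw0 : w ≠ 0 := by
    rintro rfl
    exact hw isAlgebraic_zero
  intro h
  obtain ⟨m, hm⟩ := Int.eq_ofNat_of_zero_le (show 0 ≤ -n - 1 by omega)
  refine inv_notMem_regularAt hw ?_
  have h1 := (regularAt k w).mul_mem (pow_mem (self_mem_regularAt w) m) h
  rwa [← zpow_natCast, ← zpow_add₀ hw0, ← hm, show -n - 1 + n = -1 by ring, zpow_neg_one] at h1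

/-- A derivative has no simple pole in characteristic zero: if `z` is regular at `0` so is `d z`,
and if `z` has a pole of order `r ≥ 1` then `d z` has one of order `r + 1 ≥ 2`, which nothing else
cancels. -/
theorem residue_eq_zero [CharZero k] {w : A} (hw : Transcendental k w)
    (hgen : ∀ y : A, ∃ p q : k[X], y = aeval w p / aeval w q)
    (d : Derivation k A A) (hd : d w = 1) {e : k} {o z : A} (ho : o ∈ regularAt k w)
    (h : algebraMap k A e * w⁻¹ + o + d z = 0) : e = 0 := by
  have hw0 : w ≠ 0 := by
    rintro rfl
    exact hw isAlgebraic_zero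
  have hO : ∀ x ∈ regularAt k w, d x ∈ regularAt k w := fun x hx =>
    derivation_mem_regularAt d hd hx
  have fin : z ∈ regularAt k w → e = 0 := by
    intro hz
    by_contra he
    apply inv_notMem_regularAt hw
    have : w⁻¹ = algebraMap k A e⁻¹ * (-o - d z) := by
      have he' : algebraMap k A e ≠ 0 := by simpa using he
      rw [map_inv₀]
      field_simp
      field_simp at h
      linear_combination h
    rw [this]
    exact mul_mem (algebraMap_mem _ _) (sub_mem (neg_mem ho) (hO z hz))
  by_cases hz0 : z = 0
  · exact fin (hz0 ▸ zero_mem _)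
  obtain ⟨n, a, ha, ha', rfl⟩ := exists_zpow_mul_regularAt hw hz0 (hgen z)
  rcases le_or_gt 0 n with hn | hn
  · obtain ⟨m, rfl⟩ := Int.eq_ofNat_of_zero_le hn
    refine fin (mul_mem ?_ ha)
    rw [zpow_natCast]
    exact pow_mem (self_mem_regularAt w) m
  · exfalso
    obtain ⟨m, hm⟩ := Int.eq_ofNat_of_zero_le (show 0 ≤ -n - 1 by omega)
    obtain rfl : n = -(m : ℤ) - 1 := by omega
    have ha0 : a ≠ 0 := by
      rintro rfl
      simp at hz0
    apply inv_notMem_regularAt hw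
    have hne : algebraMap k A ((m : k) + 1) ≠ 0 := by
      rw [ne_eq, map_eq_zero]
      exact Nat.cast_add_one_ne_zero m
    have hd1 : d (w ^ (-(m : ℤ) - 1)) = -((m : A) + 1) * (w ^ (m + 2))⁻¹ := by
      rw [show (-(m : ℤ) - 1) = -((m + 1 : ℕ) : ℤ) by push_cast; ring, zpow_neg, zpow_natCast,
        Derivation.leibniz_inv, Derivation.leibniz_pow, hd]
      simp only [smul_eq_mul, nsmul_eq_mul, Nat.cast_add, Nat.cast_one, Nat.add_sub_cancel,
        mul_one, pow_succ]
      field_simp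
    -- Here `z = a w^-(m+1)`; the relation multiplied by `w^(m+1)` is solved for the leading term
    -- `(m+1) a w⁻¹` of the derivative.
    have : w⁻¹ = algebraMap k A ((m : k) + 1)⁻¹ * a⁻¹ *
        (algebraMap k A e * w ^ m + o * w ^ (m + 1) + d a) := by
      rw [Derivation.leibniz, hd1,
        show (-(m : ℤ) - 1) = -((m + 1 : ℕ) : ℤ) by push_cast; ring, zpow_neg, zpow_natCast] at h
      rw [map_inv₀]
      rw [map_add, map_natCast, map_one] at hne ⊢
      field_simp
      simp only [smul_eq_mul, pow_succ] at h
      field_simp at h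
      linear_combination (-1 : A) * h
    rw [this]
    have hwm := self_mem_regularAt (k := k) w
    exact mul_mem (mul_mem (algebraMap_mem _ _) ha')
      (add_mem (add_mem (mul_mem (algebraMap_mem _ _) (pow_mem hwm _))
        (mul_mem ho (pow_mem hwm _))) (hO a ha))

/-- A relation `∑ bᵢ dyᵢ/yᵢ + dz = 0` over `k(w)` with `bᵢ` linearly independent over `ℤ`
involves no nonzero power of `w` among the `yᵢ`. -/
theorem eq_zero_of_sum_logDeriv_eq_zero [CharZero k] {w : A} (hw : Transcendental k w)
    (hgen : ∀ y : A, ∃ p q : k[X], y = aeval w p / aeval w q)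
    (d : Derivation k A A) (hd : d w = 1) {ι : Type*} [Fintype ι] {b : ι → k}
    (hb : LinearIndependent ℤ b) {y : ι → A} (hy : ∀ i, y i ≠ 0) {z : A}
    (h : ∑ i, algebraMap k A (b i) * (d (y i) / y i) + d z = 0) {i : ι} {m : ℕ}
    (hi : y i = w ^ m) : m = 0 := by
  have hw0 : w ≠ 0 := by
    rintro rfl
    exact hw isAlgebraic_zero
  choose n a ha ha' hya using fun i => exists_zpow_mul_regularAt hw (hy i) (hgen (y i))
  have ha0 : ∀ i, a i ≠ 0 := by
    intro i h0
    apply hy i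
    rw [hya, h0, mul_zero]
  have hlog : ∀ i, d (y i) / y i = (n i : A) * w⁻¹ + d (a i) * (a i)⁻¹ := by
    intro i
    have hzp : d (w ^ n i) = n i * w ^ n i * w⁻¹ := by
      rw [Derivation.leibniz_zpow, hd, zpow_sub_one₀ hw0]
      simp [mul_assoc]
    rw [hya i, Derivation.leibniz, hzp]
    have := zpow_ne_zero (n i) hw0
    have := ha0 i
    simp only [smul_eq_mul]
    field_simp
    ring
  -- The left side is the residue of `∑ bᵢ dyᵢ/yᵢ`, where `n i` is the order of `y i` at `w = 0`.
  have hsum : ∑ i, n i • b i = 0 := by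
    refine residue_eq_zero hw hgen d hd (z := z)
      (o := ∑ i, algebraMap k A (b i) * (d (a i) * (a i)⁻¹)) ?_ ?_
    · exact sum_mem fun i _ => mul_mem (algebraMap_mem _ _)
        (mul_mem (derivation_mem_regularAt d hd (ha i)) (ha' i))
    · rw [← h, map_sum, Finset.sum_mul, ← Finset.sum_add_distrib]
      congr 1
      refine Finset.sum_congr rfl fun i _ => ?_
      rw [hlog]
      simp only [zsmul_eq_mul, map_mul, map_intCast]
      ring
  have hn : n i = 0 := Fintype.linearIndependent_iff.1 hb n hsum i
  have h1 := hya i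
  rw [hi, hn, zpow_zero, one_mul] at h1
  by_contra hm
  refine zpow_notMem_regularAt (k := k) hw (n := -(m : ℤ)) (by omega) ?_
  rw [zpow_neg, zpow_natCast, h1]
  exact ha' i

end Residue

/-! ### Descent by trace and norm -/

section Descent

open Differential

/-- A relation `∑ cᵢ uᵢ'/uᵢ + v' = ρ` between elements algebraic over `A` descends to `A`, up to
multiplication by a positive integer. -/
theorem exists_logDeriv_descent {A L : Type*} [Field A] [Field L] [CharZero A] [Algebra A L]
    [Differential A] [Differential L] [DifferentialAlgebra A L] {ι : Type*} [Fintype ι]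
    (c : ι → A) {u : ι → L} (hu : ∀ i, u i ≠ 0) (hua : ∀ i, IsAlgebraic A (u i)) {v : L}
    (hv : IsAlgebraic A v) {ρ : A}
    (h : ∑ i, algebraMap A L (c i) * logDeriv (u i) + v′ = algebraMap A L ρ) :
    ∃ m : ℕ, 0 < m ∧ ∃ (y : ι → A) (z : A), (∀ i, y i ≠ 0) ∧
      (∀ i a, u i = algebraMap A L a → y i = a ^ m) ∧
      (∀ a, v = algebraMap A L a → z = m * a) ∧
      ∑ i, c i * logDeriv (y i) + z′ = m * ρ := by
  let B := IntermediateField.adjoin A (Set.range u ∪ {v})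
  have hfin : FiniteDimensional A B := by
    refine IntermediateField.finiteDimensional_adjoin ?_
    rintro x (⟨i, rfl⟩ | rfl)
    · exact (hua i).isIntegral
    · exact hv.isIntegral
  have hval : ∀ x : B, (x : L)′ = ((x′ : B) : L) := fun x =>
    (algHom_deriv' B.val B.val.injective x).symm
  let u' : ι → B := fun i => ⟨u i, IntermediateField.subset_adjoin _ _ (Or.inl ⟨i, rfl⟩)⟩
  let v' : B := ⟨v, IntermediateField.subset_adjoin _ _ (Or.inr rfl)⟩
  have hu' : ∀ i, u' i ≠ 0 := fun i h0 => hu i (congrArg Subtype.val h0)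
  have hB : ∑ i, c i • logDeriv (u' i) + v'′ = algebraMap A B ρ := by
    apply B.val.injective
    rw [map_add, map_sum]
    simp only [Differential.logDeriv]
    change _ = algebraMap A L ρ
    rw [← h]
    simp only [Algebra.smul_def, Differential.logDeriv]
    rw [show v′ = B.val v'′ from hval v']
    congr 1
    refine Finset.sum_congr rfl fun i _ => ?_
    rw [show (u i)′ = B.val (u' i)′ from hval (u' i)]
    rfl
  have htr := congrArg (Algebra.trace A B) hB
  rw [map_add, map_sum, Algebra.trace_algebraMap, ← Algebra.trace_deriv] at htr
  simp only [map_smul, smul_eq_mul] at htr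
  -- Taking the trace of the relation replaces each `u i` by its norm and `v` by its trace, with `m
  -- = [B : A]`.
  refine ⟨Module.finrank A B, Module.finrank_pos, fun i => Algebra.norm A (u' i),
    Algebra.trace A B v', fun i => Algebra.norm_ne_zero_iff.2 (hu' i), ?_, ?_, ?_⟩
  · intro i a ha
    change Algebra.norm A (u' i) = _
    rw [show u' i = algebraMap A B a from Subtype.ext ha, Algebra.norm_algebraMap]
  · intro a ha
    rw [show v' = algebraMap A B a from Subtype.ext ha, Algebra.trace_algebraMap, nsmul_eq_mul]
  · rw [← nsmul_eq_mul, ← htr]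
    congr 1
    exact Finset.sum_congr rfl fun i _ => by rw [Algebra.logDeriv_norm (hu' i)]

end Descent

/-! ### Logarithmic relations in transcendence degree one -/

section SimpleTranscendental

open Polynomial IntermediateField

variable {k L : Type*} [Field k] [Field L] [Algebra k L]

/-- Exchange property: `t` is algebraic over `k(w)`. -/
theorem Transcendental.isAlgebraic_adjoin_simple {t w x : L} (ht : Transcendental k t)
    (hw : Transcendental k w) (htw : IsAlgebraic k⟮t⟯ w) (hx : IsAlgebraic k⟮t⟯ x) :
    IsAlgebraic k⟮w⟯ x := by
  rw [isAlgebraic_adjoin_iff] at htw hx ⊢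
  refine hx.adjoin_of_forall_isAlgebraic ?_
  rintro _ ⟨rfl, -⟩
  exact IsAlgebraic.adjoin_singleton (A := L) ht hw htw

/-- The restriction of a derivation to an intermediate field. -/
def Derivation.restrictField (d : Derivation ℤ L L) (A : IntermediateField k L)
    (h : ∀ x ∈ A, d x ∈ A) : Derivation ℤ A A :=
  Derivation.mk' (AddMonoidHom.toIntLinearMap
    { toFun := fun x => ⟨d x, h x x.2⟩
      map_zero' := Subtype.ext (map_zero d)
      map_add' := fun a b => Subtype.ext (map_add d (a : L) b) })
    (fun a b => Subtype.ext (d.leibniz (a : L) b))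

theorem Derivation.apply_mem_adjoin (d : Derivation ℤ L L) {S : Set L}
    (hk : ∀ a : k, d (algebraMap k L a) ∈ adjoin k S) (hS : ∀ s ∈ S, d s ∈ adjoin k S)
    {x : L} (hx : x ∈ adjoin k S) : d x ∈ adjoin k S := by
  induction hx using adjoin_induction with
  | mem x hx => exact hS x hx
  | algebraMap x => exact hk x
  | add x y hx hy h h' => rw [map_add]; exact add_mem h h'
  | inv x hx h =>
    rw [Derivation.leibniz_inv, smul_eq_mul]
    exact mul_mem (neg_mem (pow_mem (inv_mem hx) 2)) h
  | mul x y hx hy h h' =>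
    rw [Derivation.leibniz]
    exact add_mem (mul_mem hx h') (mul_mem hy h)

theorem Derivation.eq_zero_of_mem_adjoin {R : Type*} [CommRing R] [Algebra R L]
    (d : Derivation R L L) {S : Set L}
    (hk : ∀ a : k, d (algebraMap k L a) = 0) (hS : ∀ s ∈ S, d s = 0)
    {x : L} (hx : x ∈ adjoin k S) : d x = 0 := by
  induction hx using adjoin_induction with
  | mem x hx => exact hS x hx
  | algebraMap x => exact hk x
  | add x y hx hy h h' => rw [map_add, h, h', add_zero]
  | inv x hx h => rw [Derivation.leibniz_inv, h, smul_zero]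
  | mul x y hx hy h h' => rw [Derivation.leibniz, h, h', smul_zero, smul_zero, add_zero]

theorem exists_aeval_gen_div (w : L) (y : k⟮w⟯) :
    ∃ p q : k[X], y = aeval (AdjoinSimple.gen k w) p / aeval (AdjoinSimple.gen k w) q := by
  obtain ⟨p, q, h⟩ := (mem_adjoin_simple_iff k (y : L)).1 y.2
  refine ⟨p, q, Subtype.ext ?_⟩
  rw [h]
  have key : ∀ p : k[X], aeval w p = ((aeval (AdjoinSimple.gen k w) p : k⟮w⟯) : L) := fun p =>
    aeval_algebraMap_apply L (AdjoinSimple.gen k w) p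
  rw [key, key]
  rfl

variable [CharZero k]

/-- If `f` were transcendental over `k`, then `t` would be algebraic over `k(f)`, where `δ`
vanishes, forcing `δ t = 0`. -/
theorem mem_range_of_derivation_eq_zero (hk : ∀ x : L, IsAlgebraic k x → x ∈ (algebraMap k L).range)
    (δ : Derivation k L L) {t : L} (ht : Transcendental k t) (hδ : δ t ≠ 0) {f : L}
    (hf : IsAlgebraic k⟮t⟯ f) (h : δ f = 0) : f ∈ (algebraMap k L).range := by
  by_contra hcon
  have hf' : Transcendental k f := fun ha => hcon (hk f ha)
  refine hδ (δ.eq_zero_of_isAlgebraic (A := k⟮f⟯) (fun a => ?_)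
    (ht.isAlgebraic_adjoin_simple hf' hf (isAlgebraic_algebraMap (AdjoinSimple.gen k t))))
  refine δ.eq_zero_of_mem_adjoin (k := k) (S := {f}) (fun a => δ.map_algebraMap a) ?_ a.2
  rintro _ rfl
  exact h

/-- If `∑ bᵢ δuᵢ/uᵢ + δv = 0` in a field of transcendence degree one over `k`, with the `bᵢ ∈ k`
linearly independent over `ℤ`, then the `uᵢ` lie in `k`. -/
theorem mem_range_of_sum_logDeriv_eq_zero
    (hk : ∀ x : L, IsAlgebraic k x → x ∈ (algebraMap k L).range)
    (δ : Derivation k L L) {t : L} (ht : Transcendental k t) (hδ : δ t ≠ 0)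
    {ι : Type*} [Fintype ι] {b : ι → k} (hb : LinearIndependent ℤ b) {u : ι → L}
    (hu : ∀ i, u i ≠ 0) (hut : ∀ i, IsAlgebraic k⟮t⟯ (u i)) {v : L} (hv : IsAlgebraic k⟮t⟯ v)
    (h : ∑ i, algebraMap k L (b i) * (δ (u i) / u i) + δ v = 0) (i : ι) :
    u i ∈ (algebraMap k L).range := by
  by_contra hcon
  have hδw : δ (u i) ≠ 0 := fun h0 =>
    hcon (mem_range_of_derivation_eq_zero hk δ ht hδ (hut i) h0)
  set w := u i with hw_def
  have hw : Transcendental k w := fun ha => hcon (hk _ ha)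
  have hwt : ∀ x, IsAlgebraic k⟮t⟯ x → IsAlgebraic k⟮w⟯ x := fun x hx =>
    ht.isAlgebraic_adjoin_simple hw (hut i) hx
  -- The rescaling makes the derivation restrict to `d/dw` on `k(w)` and leaves the relation
  -- homogeneous.
  let δ' : Derivation k L L := (δ w)⁻¹ • δ
  have hδ' : ∀ x, δ' x = (δ w)⁻¹ * δ x := fun x => rfl
  have hstable : ∀ x ∈ k⟮w⟯, (δ'.restrictScalars ℤ) x ∈ k⟮w⟯ := by
    intro x hx
    refine Derivation.apply_mem_adjoin _ (fun a => ?_) ?_ hx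
    · change δ' (algebraMap k L a) ∈ _
      rw [δ'.map_algebraMap]
      exact zero_mem _
    · rintro _ rfl
      change δ' w ∈ _
      rw [hδ', inv_mul_cancel₀ hδw]
      exact one_mem _
  let _ : Differential L := ⟨δ'.restrictScalars ℤ⟩
  let _ : Differential k⟮w⟯ := ⟨(δ'.restrictScalars ℤ).restrictField k⟮w⟯ hstable⟩
  have _ : DifferentialAlgebra k⟮w⟯ L := ⟨fun a => rfl⟩
  obtain ⟨m, hm, y, z, hy, hyw, -, hrel⟩ := exists_logDeriv_descent (A := k⟮w⟯) (L := L)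
    (fun j => algebraMap k k⟮w⟯ (b j)) hu (fun j => hwt _ (hut j)) (hwt v hv) (ρ := 0) (by
      rw [map_zero]
      have h1 := congrArg (fun x => (δ w)⁻¹ * x) h
      simp only [mul_zero, mul_add, Finset.mul_sum] at h1
      rw [← h1]
      congr 1
      refine Finset.sum_congr rfl fun j _ => ?_
      change algebraMap k L (b j) * (δ' (u j) / u j) = _
      rw [hδ']
      ring)
  let d : Derivation k k⟮w⟯ k⟮w⟯ := Derivation.mk'
    { toFun := fun x => ⟨δ' x, hstable x x.2⟩
      map_add' := fun a b => Subtype.ext (map_add δ' (a : L) b)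
      map_smul' := fun a b => Subtype.ext (δ'.map_smul a (b : L)) }
    (fun a b => Subtype.ext (δ'.leibniz (a : L) b))
  have hgen : Transcendental k (AdjoinSimple.gen k w) := by
    rwa [← transcendental_algebraMap_iff (algebraMap k⟮w⟯ L).injective]
  -- The norm of `w ∈ k(w)` is `w ^ m` with `m > 0`, yet the residue at `w = 0` forces `m = 0`.
  have := eq_zero_of_sum_logDeriv_eq_zero hgen (exists_aeval_gen_div w) d
    (Subtype.ext (inv_mul_cancel₀ hδw)) hb hy (z := z) (by
      rw [mul_zero] at hrel
      exact hrel) (hyw i (AdjoinSimple.gen k w) rfl)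
  omega

end SimpleTranscendental

/-! ### Consequences of a new constant -/

section NewConstants

open Polynomial IntermediateField Differential

theorem adjoin_constant_stable {k L : Type*} [Field k] [Field L] [Algebra k L]
    [Differential k] [Differential L] [DifferentialAlgebra k L] {h : L} (hc : h′ = 0) :
    ∀ x ∈ k⟮h⟯, (deriv : Derivation ℤ L L) x ∈ k⟮h⟯ := by
  intro x hx
  refine Derivation.apply_mem_adjoin _ (fun a => ?_) ?_ hx
  · rw [deriv_algebraMap]
    exact IntermediateField.algebraMap_mem _ _
  · rintro _ rfl
    rw [hc]
    exact zero_mem _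

variable {k L : Type*} [Field k] [Field L] [Algebra k L] [CharZero k]
  [Differential k] [Differential L] [DifferentialAlgebra k L]

/-- Differential equations `T' = β T + γ` that are solvable in `k(h)`, where `h` is a
transcendental constant, are solvable in `k`. -/
theorem exists_specialization {h : L} (hh : Transcendental k h) (hc : h′ = 0) {T : L}
    (hT : T ∈ k⟮h⟯) (hT0 : T ≠ 0) :
    ∃ b : k, b ≠ 0 ∧ ∀ β γ : k, T′ = algebraMap k L β * T + algebraMap k L γ →
      b′ = β * b + γ := by
  obtain ⟨p, q, rfl⟩ := (mem_adjoin_simple_iff k T).1 hT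
  have hp : p ≠ 0 := by rintro rfl; simp at hT0
  have hq : q ≠ 0 := by rintro rfl; simp at hT0
  have hq' : aeval h q ≠ 0 := by
    intro h0
    simp [h0] at hT0
  -- An integer is a constant, so substituting it for `h` commutes with differentiation; it only has
  -- to avoid the zeros of `p` and `q`.
  obtain ⟨N, hN⟩ : ∃ N : ℕ, (p * q).eval (N : k) ≠ 0 := by
    by_contra! hcon
    refine mul_ne_zero hp hq (Polynomial.eq_zero_of_infinite_isRoot _
      ((Set.infinite_range_of_injective (Nat.cast_injective (R := k))).mono ?_))
    rintro _ ⟨N, rfl⟩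
    exact hcon N
  rw [eval_mul] at hN
  have hpN := left_ne_zero_of_mul hN
  have hqN := right_ne_zero_of_mul hN
  refine ⟨p.eval (N : k) / q.eval (N : k), div_ne_zero hpN hqN, fun β γ hT' => ?_⟩
  have hNc : ((N : k))′ = 0 := Derivation.map_natCast _ N
  have hderiv : ∀ r : k[X], (r.eval (N : k))′ = (mapCoeffs r).eval (N : k) := by
    intro r
    have := deriv_aeval_eq (N : k) r
    rwa [hNc, mul_zero, add_zero] at this
  have hderiv' : ∀ r : k[X], (aeval h r)′ = aeval h (mapCoeffs r) := by
    intro r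
    have := deriv_aeval_eq h r
    rwa [hc, mul_zero, add_zero] at this
  -- As `h` is transcendental, the differential equation becomes an identity of polynomials over
  -- `k`.
  have hpoly : mapCoeffs p * q - p * mapCoeffs q = C β * p * q + C γ * q ^ 2 := by
    apply transcendental_iff_injective.1 hh
    simp only [map_sub, map_mul, map_add, map_pow, aeval_C, ← hderiv']
    rw [Derivation.leibniz_div] at hT'
    simp only [smul_eq_mul] at hT'
    field_simp at hT'
    linear_combination hT'
  have := congrArg (eval (N : k)) hpoly
  simp only [eval_sub, eval_mul, eval_add, eval_pow, eval_C, ← hderiv] at this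
  rw [Derivation.leibniz_div]
  simp only [smul_eq_mul]
  field_simp
  linear_combination this

variable {h t : L} {r : k}

/-- The trace of `t` solves the equation in `k(h)` up to the degree `m`; specializing `h` gives a
solution in `k`. -/
theorem exists_deriv_eq_of_new_constant (hh : Transcendental k h) (hc : h′ = 0)
    (ht : IsAlgebraic k⟮h⟯ t) (htr : t′ = algebraMap k L r) :
    ∃ (m : ℕ) (b : k), 0 < m ∧ b′ = m * r := by
  let _ : Differential k⟮h⟯ := ⟨deriv.restrictField k⟮h⟯ (adjoin_constant_stable hc)⟩
  have _ : DifferentialAlgebra k⟮h⟯ L := ⟨fun a => rfl⟩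
  obtain ⟨m, hm, _, z, -, -, -, hz⟩ := exists_logDeriv_descent (A := k⟮h⟯) (L := L) (ι := Empty)
    Empty.elim (u := Empty.elim) (fun i => i.elim) (fun i => i.elim) ht
    (ρ := algebraMap k k⟮h⟯ r) (by simpa using htr)
  rw [Fintype.sum_empty, zero_add] at hz
  have hz' : ((z : L))′ = algebraMap k L (m * r) := by
    rw [map_mul, map_natCast]
    exact congrArg (algebraMap k⟮h⟯ L) hz
  by_cases hz0 : (z : L) = 0
  · refine ⟨m, 0, hm, ?_⟩
    rw [hz0, map_zero] at hz'
    rw [map_zero]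
    exact (algebraMap k L).injective (by rw [map_zero]; exact hz')
  · obtain ⟨b, -, hb⟩ := exists_specialization hh hc z.2 hz0
    refine ⟨m, b, hm, ?_⟩
    have := hb 0 (m * r) (by rw [map_zero, zero_mul, zero_add]; exact hz')
    rwa [zero_mul, zero_add] at this

/-- Multiplicative analogue, with the norm of `t` in place of the trace. -/
theorem exists_deriv_eq_mul_of_new_constant (hh : Transcendental k h) (hc : h′ = 0)
    (ht : IsAlgebraic k⟮h⟯ t) (ht0 : t ≠ 0) (htr : t′ = algebraMap k L r * t) :
    ∃ (m : ℕ) (b : k), 0 < m ∧ b ≠ 0 ∧ b′ = m * r * b := by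
  let _ : Differential k⟮h⟯ := ⟨deriv.restrictField k⟮h⟯ (adjoin_constant_stable hc)⟩
  have _ : DifferentialAlgebra k⟮h⟯ L := ⟨fun a => rfl⟩
  obtain ⟨m, hm, y, z, hy, -, hz0, hz⟩ := exists_logDeriv_descent (A := k⟮h⟯) (L := L) (ι := Unit)
    (fun _ => 1) (u := fun _ => t) (fun _ => ht0) (fun _ => ht) (v := 0) isAlgebraic_zero
    (ρ := algebraMap k k⟮h⟯ r) (by
      rw [map_zero, add_zero, Fintype.sum_unique, map_one, one_mul, Differential.logDeriv, htr,
        mul_div_cancel_right₀ _ ht0]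
      rfl)
  have hz1 : z = 0 := by simpa using hz0 0 (map_zero _).symm
  rw [Fintype.sum_unique, hz1, map_zero, add_zero, one_mul, Differential.logDeriv,
    div_eq_iff (hy _)] at hz
  have hz' : ((y default : L))′ = algebraMap k L (m * r) * y default := by
    rw [map_mul, map_natCast]
    exact congrArg (algebraMap k⟮h⟯ L) hz
  obtain ⟨b, hb0, hb⟩ := exists_specialization hh hc (y default).2
    (fun h0 => hy default (Subtype.ext h0))
  refine ⟨m, b, hm, hb0, ?_⟩
  have := hb (m * r) 0 (by rw [map_zero, add_zero]; exact hz')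
  rwa [add_zero] at this

end NewConstants

/-! ### Constants of the rational function field -/

section RationalConstants

open MvPolynomial

variable {σ F : Type*} [Field F]

theorem MvPolynomial.eq_C_of_pderiv_eq_zero [CharZero F] {p : MvPolynomial σ F} (h : ∀ i, pderiv i p = 0) :
    p = C (coeff 0 p) := by
  classical
  ext m
  rw [coeff_C]
  split_ifs with hm
  · rw [hm]
  · obtain ⟨i, hi⟩ := Finsupp.ne_iff.1 (Ne.symm hm)
    have h1 := coeff_pderiv (i := i) p (m - Finsupp.single i 1)
    have h2 : m - Finsupp.single i 1 + Finsupp.single i 1 = m := by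
      apply tsub_add_cancel_of_le
      rw [Finsupp.single_le_iff]
      exact Nat.one_le_iff_ne_zero.2 hi
    rw [h i, coeff_zero, h2] at h1
    rcases mul_eq_zero.1 h1.symm with h3 | h3
    · exact h3
    · exact absurd h3 (Nat.cast_add_one_ne_zero _)

/-- A nonzero partial derivative has smaller total degree than `p`. -/
theorem MvPolynomial.pderiv_eq_zero_of_dvd {p : MvPolynomial σ F} {i : σ}
    (h : p ∣ pderiv i p) : pderiv i p = 0 := by
  by_contra hne
  obtain ⟨s, hs⟩ := h
  have hp : p ≠ 0 := by rintro rfl; simp at hne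
  have hs0 : s ≠ 0 := by rintro rfl; simp [hs] at hne
  have h1 : p.totalDegree ≤ (pderiv i p).totalDegree := by
    rw [hs, totalDegree_mul_of_isDomain hp hs0]
    exact Nat.le_add_right _ _
  obtain ⟨m, hm, hm'⟩ := Finset.exists_mem_eq_sup _ (support_nonempty.2 hne)
    (fun m : σ →₀ ℕ => m.sum fun _ e => e)
  change (pderiv i p).totalDegree = _ at hm'
  rw [mem_support_iff, coeff_pderiv] at hm
  have h2 := le_totalDegree (mem_support_iff.2 (left_ne_zero_of_mul hm))
  rw [Finsupp.sum_add_index' (fun _ => rfl) (fun _ _ _ => rfl),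
    Finsupp.sum_single_index rfl] at h2
  omega

/-- For `f = p/q` in lowest terms, `(∂p) q = (∂q) p` gives `q ∣ ∂q`, hence `∂q = 0` and then `∂p =
0`. -/
theorem RatFunField.mem_range_of_partialDeriv_eq_zero {n : ℕ} {f : RatFunField n}
    (h : ∀ i, RatFunField.partialDeriv i f = 0) : ∃ c : ℂ, f = algebraMap ℂ (RatFunField n) c := by
  set R := MvPolynomial (Fin n) ℂ
  set p : R := IsFractionRing.num R f
  set q : R := (IsFractionRing.den R f : R)
  have hq0 : q ≠ 0 := nonZeroDivisors.coe_ne_zero _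
  have hrel : IsRelPrime p q := IsFractionRing.num_den_reduced R f
  have hinj : Function.Injective (algebraMap R (RatFunField n)) := IsFractionRing.injective _ _
  have hf : f * algebraMap R (RatFunField n) q = algebraMap R (RatFunField n) p :=
    IsLocalization.mk'_eq_iff_eq_mul.1 (IsFractionRing.mk'_num_den R f) |>.symm
  have hpq : ∀ i, pderiv i p * q = pderiv i q * p := by
    intro i
    have h1 := congrArg (RatFunField.partialDeriv i) hf
    rw [Derivation.leibniz, h i, smul_zero, add_zero, RatFunField.partialDeriv_algebraMap,
      RatFunField.partialDeriv_algebraMap, smul_eq_mul] at h1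
    apply hinj
    rw [map_mul, map_mul, ← h1, ← hf]
    ring
  have hq : ∀ i, pderiv i q = 0 := fun i => pderiv_eq_zero_of_dvd
    (hrel.symm.dvd_of_dvd_mul_right (Dvd.intro_left _ (hpq i)))
  have hp : ∀ i, pderiv i p = 0 := fun i => by
    have := hpq i
    rw [hq i, zero_mul] at this
    exact (mul_eq_zero.1 this).resolve_right hq0
  have hq1 := eq_C_of_pderiv_eq_zero hq
  have hp1 := eq_C_of_pderiv_eq_zero hp
  have halg : ∀ c : ℂ, algebraMap R (RatFunField n) (C c) = algebraMap ℂ (RatFunField n) c :=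
    fun c => (IsScalarTower.algebraMap_apply ℂ R (RatFunField n) c).symm
  have hc0 : coeff 0 q ≠ 0 := by
    intro h0
    rw [h0, C_0] at hq1
    exact hq0 hq1
  refine ⟨coeff 0 p / coeff 0 q, ?_⟩
  rw [hp1, hq1, halg, halg] at hf
  rw [map_div₀, eq_div_iff (by simpa using hc0), hf]

end RationalConstants

/-! ### The wedge product with `Ω` as a contraction -/

section Exterior

variable {n : ℕ} {L : Type*} [Field L]

theorem ExteriorAlgebra.ι_mul_prod_map_of_mem {ι' M : Type*} [DecidableEq ι'] [AddCommGroup M]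
    [Module L M] (e : ι' → M) {i : ι'} {l : List ι'} (hi : i ∈ l) :
    ExteriorAlgebra.ι L (e i) * (l.map fun j => ExteriorAlgebra.ι L (e j)).prod = 0 := by
  induction l with
  | nil => simp at hi
  | cons x l ih =>
    rw [List.map_cons, List.prod_cons, ← mul_assoc]
    by_cases hx : i = x
    · rw [hx, ExteriorAlgebra.ι_sq_zero, zero_mul]
    · rw [eq_neg_of_add_eq_zero_left (ExteriorAlgebra.ι_add_mul_swap (e i) (e x)), neg_mul,
        mul_assoc, ih ((List.mem_cons.1 hi).resolve_left hx), mul_zero, neg_zero]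

theorem ExteriorAlgebra.exists_ι_mul_prod_filter {ι' M : Type*} [DecidableEq ι'] [AddCommGroup M]
    [Module L M] (e : ι' → M) {i : ι'} {l : List ι'} (hl : l.Nodup) (hi : i ∈ l) :
    ∃ ε : ℤˣ, ExteriorAlgebra.ι L (e i) *
      ((l.filter fun j => j ≠ i).map fun j => ExteriorAlgebra.ι L (e j)).prod =
        (ε : ℤ) • (l.map fun j => ExteriorAlgebra.ι L (e j)).prod := by
  induction l with
  | nil => simp at hi
  | cons x l ih =>
    rw [List.nodup_cons] at hl
    by_cases hx : i = x
    · subst hx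
      refine ⟨1, ?_⟩
      have : l.filter (fun j => j ≠ i) = l := by
        rw [List.filter_eq_self]
        intro a ha
        simp only [ne_eq, decide_not, Bool.not_eq_eq_eq_not, Bool.not_true, decide_eq_false_iff_not]
        rintro rfl
        exact hl.1 ha
      rw [List.filter_cons_of_neg (by simp), this]
      simp
    · obtain ⟨ε, hε⟩ := ih hl.2 ((List.mem_cons.1 hi).resolve_left hx)
      refine ⟨-ε, ?_⟩
      rw [List.filter_cons_of_pos (by simpa using Ne.symm hx), List.map_cons, List.prod_cons,
        ← mul_assoc, eq_neg_of_add_eq_zero_left (ExteriorAlgebra.ι_add_mul_swap (e i) (e x)),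
        neg_mul, mul_assoc, hε, List.map_cons, List.prod_cons, mul_smul_comm, Units.val_neg,
        neg_smul]

theorem ExteriorAlgebra.prod_ι_single_ne_zero :
    ((List.finRange n).map fun j => ExteriorAlgebra.ι L (Pi.single j (1 : L) : Fin n → L)).prod
      ≠ 0 := by
  intro h
  have h1 : ExteriorAlgebra.ιMulti L n (fun j => (Pi.single j (1 : L) : Fin n → L)) = 0 := by
    rw [ExteriorAlgebra.ιMulti_apply, List.ofFn_eq_map]
    exact h
  -- The determinant in degree `n` and zero in all others: the induced functional takes the value
  -- `1` on the volume form.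
  let f : ∀ i, (Fin n → L) [⋀^Fin i]→ₗ[L] L := fun i =>
    if hi : i = n then (Pi.basisFun L (Fin n)).det.domDomCongr (finCongr hi.symm) else 0
  have h2 := ExteriorAlgebra.liftAlternating_apply_ιMulti f
    (fun j => (Pi.single j (1 : L) : Fin n → L))
  rw [h1, map_zero] at h2
  have h3 : (Pi.basisFun L (Fin n)).det (fun j => (Pi.single j (1 : L) : Fin n → L)) = 0 := by
    rw [h2]
    simp [f]
  have h4 : (fun j => (Pi.single j (1 : L) : Fin n → L)) = Pi.basisFun L (Fin n) := by
    ext j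
    simp
  rw [h4, Module.Basis.det_self] at h3
  exact one_ne_zero h3

/-- Wedging one-forms with a fixed `(n-1)`-form vanishes exactly on the one-forms killed by a
vector field with coefficients in `ℂ(x₁, …, xₙ)`. -/
theorem exists_contraction [Algebra (RatFunField n) L] (P : Fin n → RatFunField n) :
    ∃ s : Fin n → RatFunField n, ∀ a : Fin n → L,
      ExteriorAlgebra.ι L a * nSubOneForm L P = 0 ↔
        ∑ i, algebraMap (RatFunField n) L (s i) * a i = 0 := by
  choose ε hε using fun i => ExteriorAlgebra.exists_ι_mul_prod_filter (L := L)
    (fun j => (Pi.single j (1 : L) : Fin n → L)) (List.nodup_finRange n) (List.mem_finRange i)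
  -- `ε i` is the sign of moving `dxᵢ` into its place in `dx₁ ∧ ⋯ ∧ dxₙ`.
  refine ⟨fun i => ((ε i : ℤ) : RatFunField n) * P i, fun a => ?_⟩
  have key : ExteriorAlgebra.ι L a * nSubOneForm L P =
      (∑ i, algebraMap (RatFunField n) L (((ε i : ℤ) : RatFunField n) * P i) * a i) •
      ((List.finRange n).map fun j =>
        ExteriorAlgebra.ι L (Pi.single j (1 : L) : Fin n → L)).prod := by
    have ha : a = ∑ j, a j • (Pi.single j (1 : L) : Fin n → L) := by
      ext i
      simp [Finset.sum_apply, Pi.single_apply]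
    conv_lhs => rw [ha]
    rw [map_sum, nSubOneForm, Finset.sum_mul_sum, Finset.sum_comm, Finset.sum_smul]
    refine Finset.sum_congr rfl fun i _ => ?_
    rw [Finset.sum_eq_single i]
    · rw [map_smul, smul_mul_smul_comm, hε i, ← Int.cast_smul_eq_zsmul L, smul_smul, map_mul,
        map_intCast]
      congr 1
      ring
    · intro j _ hj
      rw [map_smul, smul_mul_smul_comm, ExteriorAlgebra.ι_mul_prod_map_of_mem
        (fun j => (Pi.single j (1 : L) : Fin n → L)), smul_zero]
      simpa using hj
    · simp
  rw [key, smul_eq_zero, or_iff_left ExteriorAlgebra.prod_ι_single_ne_zero]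

end Exterior

/-! ### Calculus of logarithmic forms -/

section LogSum

variable {L : Type*} [Field L]

/-- The value `∑ cₖ uₖ'/uₖ + v'` of a logarithmic form on a derivation. -/
def logSum (d : Derivation ℤ L L) {M : ℕ} (c u : Fin M → L) (v : L) : L :=
  ∑ k, c k * ((u k)⁻¹ * d (u k)) + d v

theorem logSum_cons (d : Derivation ℤ L L) {M : ℕ} (c u : Fin M → L) (v c₀ u₀ : L) :
    logSum d (Fin.cons c₀ c : Fin (M + 1) → L) (Fin.cons u₀ u : Fin (M + 1) → L) v =
      c₀ * (u₀⁻¹ * d u₀) + logSum d c u v := by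
  simp [logSum, Fin.sum_univ_succ, add_assoc]

theorem logSum_add_right (d : Derivation ℤ L L) {M : ℕ} (c u : Fin M → L) (v v' : L) :
    logSum d c u (v + v') = logSum d c u v + d v' := by
  simp [logSum, add_assoc]

theorem Derivation.sum_smul_apply {n : ℕ} (D : Fin n → Derivation ℤ L L) (s : Fin n → L) (x : L) :
    (∑ i, s i • D i) x = ∑ i, s i * D i x :=
  (congrFun (map_sum Derivation.coeFnAddMonoidHom (fun i => s i • D i) Finset.univ) x).trans
    (by simp [Finset.sum_apply])

theorem logSum_sum_smul {n : ℕ} (D : Fin n → Derivation ℤ L L) (s : Fin n → L) {M : ℕ}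
    (c u : Fin M → L) (v : L) :
    logSum (∑ i, s i • D i) c u v = ∑ i, s i * logSum (D i) c u v := by
  simp only [logSum, Derivation.sum_smul_apply, mul_add, Finset.mul_sum, Finset.sum_add_distrib]
  congr 1
  rw [Finset.sum_comm]
  exact Finset.sum_congr rfl fun i _ => Finset.sum_congr rfl fun k _ => by ring

theorem Derivation.inv_mul_apply_prod_zpow (d : Derivation ℤ L L) {ι : Type*} (s : Finset ι)
    {u : ι → L} (hu : ∀ i, u i ≠ 0) (N : ι → ℤ) :
    (∏ i ∈ s, u i ^ N i)⁻¹ * d (∏ i ∈ s, u i ^ N i) =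
      ∑ i ∈ s, (N i : L) * ((u i)⁻¹ * d (u i)) := by
  classical
  induction s using Finset.induction_on with
  | empty => simp
  | insert i s hi ih =>
    rw [Finset.prod_insert hi, Finset.sum_insert hi, ← ih, Derivation.leibniz,
      Derivation.leibniz_zpow, zpow_sub_one₀ (hu i)]
    have h1 : ∏ i ∈ s, u i ^ N i ≠ 0 := Finset.prod_ne_zero_iff.2 fun i _ => zpow_ne_zero _ (hu i)
    have h2 := zpow_ne_zero (N i) (hu i)
    have h3 := hu i
    simp only [smul_eq_mul, zsmul_eq_mul]
    field_simp
    ring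

/-- The coefficients of a logarithmic form can be made linearly independent over `ℤ`. -/
theorem exists_linearIndependent_logSum {F : Type*} [Field F] [CharZero F] (φ : F →+* L) {M : ℕ}
    (c : Fin M → F) {u : Fin M → L} (hu : ∀ i, u i ≠ 0) :
    ∃ (m : ℕ) (b : Fin m → F) (N : Fin m → Fin M → ℤ), LinearIndependent ℤ b ∧
      ∀ (d : Derivation ℤ L L) (v : L), logSum d (φ ∘ c) u v =
        logSum d (φ ∘ b) (fun j => ∏ i, u i ^ N j i) v := by
  let V := Submodule.span ℤ (Set.range c)
  have : Module.Finite ℤ V := Module.Finite.span_of_finite ℤ (Set.finite_range c)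
  -- The span is finitely generated and torsion-free, hence free; the integer coordinates of the `c
  -- i` become exponents of the `u i`.
  let B := Module.finBasis ℤ V
  let e : Fin M → V := fun i => ⟨c i, Submodule.subset_span ⟨i, rfl⟩⟩
  refine ⟨_, fun j => (B j : F), fun j i => B.repr (e i) j,
    B.linearIndependent.map' V.subtype (Submodule.ker_subtype V), fun d v => ?_⟩
  have hc : ∀ i, φ (c i) = ∑ j, ((B.repr (e i) j : ℤ) : L) * φ (B j : F) := by
    intro i
    have h1 := congrArg (fun x : V => φ (x : F)) (B.sum_repr (e i))
    simp only [AddSubmonoidClass.coe_finsetSum, map_sum] at h1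
    refine h1.symm.trans (Finset.sum_congr rfl fun j _ => ?_)
    simp
  simp only [logSum, Derivation.inv_mul_apply_prod_zpow d _ hu, Function.comp_apply, hc,
    Finset.sum_mul, Finset.mul_sum]
  congr 1
  rw [Finset.sum_comm]
  exact Finset.sum_congr rfl fun j _ => Finset.sum_congr rfl fun i _ => by ring

/-- Closedness of a logarithmic form `ω` with constant coefficients, evaluated on commuting
derivations: `X(ω(δ)) = δ(ω(X))`. -/
theorem logSum_comm {X δ : Derivation ℤ L L} {M : ℕ} {c u : Fin M → L} {v : L}
    (hu : ∀ k, u k ≠ 0) (hXc : ∀ k, X (c k) = 0) (hδc : ∀ k, δ (c k) = 0)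
    (hcu : ∀ k, X (δ (u k)) = δ (X (u k))) (hcv : X (δ v) = δ (X v)) :
    X (logSum δ c u v) = δ (logSum X c u v) := by
  simp only [logSum, map_add, map_sum, hcv]
  congr 1
  refine Finset.sum_congr rfl fun k _ => ?_
  have := hu k
  simp only [Derivation.leibniz, Derivation.leibniz_inv, hXc, hδc, hcu, smul_eq_mul]
  ring

end LogSum

/-! ### Relations and forms in transcendence degree one -/

section Step

open IntermediateField

variable {n : ℕ} {F k L : Type*} [Field F] [Field k] [Field L] [Algebra F L] [Algebra k L]

/-- There is a nonzero logarithmic form with entries in `S` that is killed by the derivation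
`X`. -/
def HasRelation (F : Type*) {L : Type*} [Field F] [Field L] [Algebra F L]
    (D : Fin n → Derivation ℤ L L) (X : Derivation ℤ L L) (S : Set L) : Prop :=
  ∃ (M : ℕ) (c : Fin M → F) (u : Fin M → L) (v : L), (∀ j, u j ≠ 0) ∧ (∀ j, u j ∈ S) ∧ v ∈ S ∧
    logSum X (algebraMap F L ∘ c) u v = 0 ∧ ∃ i, logSum (D i) (algebraMap F L ∘ c) u v ≠ 0

theorem HasRelation.of_apply_eq_zero {D : Fin n → Derivation ℤ L L} {X : Derivation ℤ L L}
    {S : Set L} {a : L} (ha : a ∈ S) (hX : X a = 0) {i : Fin n} (hD : D i a ≠ 0) :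
    HasRelation F D X S :=
  ⟨0, Fin.elim0, Fin.elim0, a, fun j => j.elim0, fun j => j.elim0, ha, by simpa [logSum] using hX,
    i, by simpa [logSum] using hD⟩

theorem HasRelation.of_single {D : Fin n → Derivation ℤ L L} {X : Derivation ℤ L L}
    {S : Set L} (c : F) {u v : L} (hu : u ∈ S) (hu0 : u ≠ 0) (hv : v ∈ S)
    (hX : algebraMap F L c * (u⁻¹ * X u) + X v = 0)
    {i : Fin n} (hD : algebraMap F L c * (u⁻¹ * D i u) + D i v ≠ 0) :
    HasRelation F D X S :=
  ⟨1, fun _ => c, fun _ => u, v, fun _ => hu0, fun _ => hu, hv, by simpa [logSum] using hX,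
    i, by simpa [logSum] using hD⟩

theorem HasRelation.mono {D : Fin n → Derivation ℤ L L} {X : Derivation ℤ L L}
    {S T : Set L} (hST : S ⊆ T) (h : HasRelation F D X S) : HasRelation F D X T := by
  obtain ⟨M, c, u, v, h0, hu, hv, h⟩ := h
  exact ⟨M, c, u, v, h0, fun j => hST (hu j), hST hv, h⟩

variable [CharZero k]

/-- A logarithmic form over a field of transcendence degree one over `k` that is killed by a
nonzero `k`-derivation is a logarithmic form over `k`. -/
theorem exists_logSum_eq_of_logSum_eq_zero [CharZero F] [Algebra F k] [IsScalarTower F k L]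
    (hk : ∀ x : L, IsAlgebraic k x → x ∈ (algebraMap k L).range)
    (δ : Derivation k L L) {t : L} (ht : Transcendental k t) (hδ : δ t ≠ 0)
    {M : ℕ} (c : Fin M → F) {u : Fin M → L} {v : L} (hu : ∀ i, u i ≠ 0)
    (hut : ∀ i, IsAlgebraic k⟮t⟯ (u i)) (hv : IsAlgebraic k⟮t⟯ v)
    (h : logSum (δ.restrictScalars ℤ) (algebraMap F L ∘ c) u v = 0) :
    v ∈ (algebraMap k L).range ∧ ∃ (m : ℕ) (b : Fin m → F) (w : Fin m → L), (∀ j, w j ≠ 0) ∧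
      (∀ j, w j ∈ (algebraMap k L).range) ∧ ∀ (d : Derivation ℤ L L) (v : L),
        logSum d (algebraMap F L ∘ c) u v = logSum d (algebraMap F L ∘ b) w v := by
  obtain ⟨m, b, N, hb, hN⟩ := exists_linearIndependent_logSum (algebraMap F L) c hu
  set w : Fin m → L := fun j => ∏ i, u i ^ N j i with hw_def
  have hw0 : ∀ j, w j ≠ 0 := fun j => Finset.prod_ne_zero_iff.2 fun i _ => zpow_ne_zero _ (hu i)
  have hwt : ∀ j, IsAlgebraic k⟮t⟯ (w j) := by
    intro j
    rw [← mem_algebraicClosure_iff]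
    exact prod_mem fun i _ => zpow_mem (mem_algebraicClosure_iff.2 (hut i)) _
  rw [hN] at h
  have hb' : LinearIndependent ℤ (algebraMap F k ∘ b) :=
    hb.map' (algebraMap F k).toAddMonoidHom.toIntLinearMap
      (LinearMap.ker_eq_bot.2 (algebraMap F k).injective)
  have hFk : ∀ a : F, algebraMap k L (algebraMap F k a) = algebraMap F L a := fun a =>
    (IsScalarTower.algebraMap_apply F k L a).symm
  have hw : ∀ j, w j ∈ (algebraMap k L).range := by
    refine mem_range_of_sum_logDeriv_eq_zero hk δ ht hδ hb' hw0 hwt hv ?_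
    rw [← h, logSum]
    congr 1
    refine Finset.sum_congr rfl fun j _ => ?_
    rw [Function.comp_apply, hFk, div_eq_inv_mul]
    rfl
  refine ⟨?_, m, b, w, hw0, hw, hN⟩
  -- With all `w j` in `k` the logarithmic terms vanish on `δ`, which leaves `δ v = 0`.
  refine mem_range_of_derivation_eq_zero hk δ ht hδ hv ?_
  rw [logSum, Finset.sum_eq_zero, zero_add] at h
  · exact h
  · intro j _
    obtain ⟨a, ha⟩ := hw j
    rw [← ha]
    change _ * (_ * δ _) = 0
    rw [δ.map_algebraMap, mul_zero, mul_zero]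

/-- Derivations that commute on `k` and on `t` commute on all elements algebraic over `k(t)`. -/
theorem Derivation.commute_of_isAlgebraic_adjoin (X : Derivation ℤ L L)
    (hX : ∀ a, ∃ b, X (algebraMap k L a) = algebraMap k L b) (δ : Derivation k L L) {t : L}
    (ht : X (δ t) = δ (X t)) {x : L} (hx : IsAlgebraic k⟮t⟯ x) : X (δ x) = δ (X x) := by
  -- The commutator is a derivation; it vanishes on `k`, which `X` preserves and `δ` kills, and on
  -- `t`.
  have h1 : ⁅X, δ.restrictScalars ℤ⁆ x = 0 := by
    refine Derivation.eq_zero_of_isAlgebraic (A := k⟮t⟯) _ (fun a => ?_) hx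
    refine Derivation.eq_zero_of_mem_adjoin (k := k) (S := {t}) _ (fun a => ?_) ?_ a.2
    · rw [Derivation.commutator_apply]
      change X (δ (algebraMap k L a)) - δ (X (algebraMap k L a)) = 0
      obtain ⟨b, hb⟩ := hX a
      rw [hb, δ.map_algebraMap, δ.map_algebraMap, map_zero, sub_zero]
    · rintro _ rfl
      rw [Derivation.commutator_apply]
      exact sub_eq_zero.2 ht
  rw [Derivation.commutator_apply] at h1
  exact sub_eq_zero.1 h1

theorem isAlgebraic_logSum (δ : Derivation k L L) {t : L} {M : ℕ}
    (hδ' : δ t ∈ k⟮t⟯) {c u : Fin M → L} {v : L}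
    (hc : ∀ j, IsAlgebraic k⟮t⟯ (c j)) (hu : ∀ j, IsAlgebraic k⟮t⟯ (u j))
    (hv : IsAlgebraic k⟮t⟯ v) : IsAlgebraic k⟮t⟯ (logSum (δ.restrictScalars ℤ) c u v) := by
  have key : ∀ x, IsAlgebraic k⟮t⟯ x → IsAlgebraic k⟮t⟯ ((δ.restrictScalars ℤ) x) := by
    intro x hx
    refine Derivation.isAlgebraic_apply _ (fun a => ?_) hx
    refine ⟨⟨_, Derivation.apply_mem_adjoin (k := k) (δ.restrictScalars ℤ) (S := {t})
      (fun a => ?_) ?_ a.2⟩, rfl⟩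
    · change δ (algebraMap k L a) ∈ _
      rw [δ.map_algebraMap]
      exact zero_mem _
    · rintro _ rfl
      exact hδ'
  have hv' := key v hv
  simp only [← mem_algebraicClosure_iff] at hc hu key hv' ⊢
  exact add_mem (sum_mem fun j _ => mul_mem (hc j) (mul_mem (inv_mem (hu j)) (key _ (hu j)))) hv'

end Step

/-! ### Descent through an exponential or a logarithm -/

section Descend

open IntermediateField

variable {n : ℕ} {F k L : Type*} [Field F] [Field k] [Field L] [Algebra F L] [Algebra k L]
  [CharZero k] [Algebra F k] [IsScalarTower F k L]

/-- If there is no logarithmic form over `k` killed by `X = ∑ sᵢ Dᵢ`, then an exponential or a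
logarithm over `k` introduces no new constants of `X`. -/
theorem isAlgebraic_new_constant {D : Fin n → Derivation ℤ L L} {s : Fin n → L}
    (hs : ∀ i, s i ∈ (algebraMap k L).range)
    (hD : ∀ i a, ∃ b, D i (algebraMap k L a) = algebraMap k L b)
    (hconst : ∀ f, (∀ i, D i f = 0) → f ∈ (algebraMap F L).range)
    {t R : L} (hR : R ∈ (algebraMap k L).range) (htr : Transcendental k t)
    (ht : (t ≠ 0 ∧ ∀ i, D i t = t * D i R) ∨ (R ≠ 0 ∧ ∀ i, D i t = R⁻¹ * D i R))
    (hno : ¬ HasRelation F D (∑ i, s i • D i) (algebraMap k L).range) {h : L}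
    (hht : IsAlgebraic k⟮t⟯ h) (hX : (∑ i, s i • D i) h = 0) : IsAlgebraic k h := by
  by_contra hh
  have hth : IsAlgebraic k⟮h⟯ t :=
    htr.isAlgebraic_adjoin_simple hh hht (isAlgebraic_algebraMap (AdjoinSimple.gen k t))
  have hFk : ∀ a : F, algebraMap F L a ∈ (algebraMap k L).range := fun a =>
    ⟨algebraMap F k a, (IsScalarTower.algebraMap_apply F k L a).symm⟩
  have hD' : ∀ i, ∀ x ∈ (algebraMap k L).range, D i x ∈ (algebraMap k L).range := by
    rintro i _ ⟨a, rfl⟩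
    obtain ⟨b, hb⟩ := hD i a
    exact ⟨b, hb.symm⟩
  set X := ∑ i, s i • D i with hX_def
  have hXa : ∀ x, X x = ∑ i, s i * D i x := Derivation.sum_smul_apply D s
  have hXk : ∀ x ∈ (algebraMap k L).range, X x ∈ (algebraMap k L).range := by
    intro x hx
    rw [hXa]
    exact sum_mem fun i _ => mul_mem (hs i) (hD' i x hx)
  let _ : Differential L := ⟨X⟩
  obtain ⟨_, _⟩ := Differential.exists_of_forall_exists (A := k) (L := L) (fun a => by
    obtain ⟨b, hb⟩ := hXk _ ⟨a, rfl⟩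
    exact ⟨b, hb.symm⟩)
  have hder : ∀ a : k, algebraMap k L (Differential.deriv a) = X (algebraMap k L a) := fun a =>
    (DifferentialAlgebra.deriv_algebraMap a).symm
  rcases ht with ⟨ht0, ht⟩ | ⟨hR0, ht⟩
  · have hXt : X t = X R * t := by
      rw [hXa, hXa, Finset.sum_mul]
      exact Finset.sum_congr rfl fun i _ => by rw [ht]; ring
    obtain ⟨r, hr⟩ := hXk R hR
    obtain ⟨m, b, hm, hb0, hb⟩ := exists_deriv_eq_mul_of_new_constant hh hX hth ht0
      (hXt.trans (by rw [hr]))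
    have hb0' : algebraMap k L b ≠ 0 := by simpa using hb0
    have hb' := hder b
    rw [hb, map_mul, map_mul, map_natCast, hr] at hb'
    -- `X` kills `db/b - m dR`. If this form vanishes, `b/tᵐ` is a constant and `t` is algebraic
    -- over `k`; if not, it is a forbidden relation over `k`.
    by_cases hdb : ∀ i, (algebraMap k L b)⁻¹ * D i (algebraMap k L b) = m * D i R
    · have hc : ∀ i, D i (algebraMap k L b * (t ^ m)⁻¹) = 0 := by
        intro i
        have h1 : D i (algebraMap k L b) = algebraMap k L b * (m * D i R) := by
          rw [← hdb i, mul_inv_cancel_left₀ hb0']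
        obtain ⟨l, rfl⟩ : ∃ l, m = l + 1 := ⟨m - 1, by omega⟩
        rw [Derivation.leibniz, Derivation.leibniz_inv, Derivation.leibniz_pow, h1, ht i]
        simp only [smul_eq_mul, nsmul_eq_mul, Nat.add_sub_cancel]
        field_simp
        ring
      obtain ⟨c, hc⟩ := hconst _ hc
      have htm : t ^ m = algebraMap k L b * (algebraMap F L c)⁻¹ := by
        rw [hc]
        field_simp
      apply htr
      refine IsAlgebraic.of_pow hm ?_
      rw [htm, IsScalarTower.algebraMap_apply F k L, ← map_inv₀, ← map_mul]
      exact isAlgebraic_algebraMap _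
    · push Not at hdb
      obtain ⟨i, hi⟩ := hdb
      refine hno (HasRelation.of_single (v := -(m * R)) 1 ⟨b, rfl⟩ hb0'
        (neg_mem (mul_mem (natCast_mem _ m) hR)) ?_ (i := i) ?_)
      · rw [← hb', map_one, map_neg, Derivation.leibniz, Derivation.map_natCast]
        simp only [smul_eq_mul]
        field_simp
        ring
      · rw [map_one, map_neg, Derivation.leibniz, Derivation.map_natCast]
        intro h0
        apply hi
        simp only [smul_eq_mul] at h0
        linear_combination h0
  · have hXt : X t = R⁻¹ * X R := by
      rw [hXa, hXa, Finset.mul_sum]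
      exact Finset.sum_congr rfl fun i _ => by rw [ht]; ring
    obtain ⟨r, hr⟩ : R⁻¹ * X R ∈ (algebraMap k L).range := by
      obtain ⟨a, rfl⟩ := hR
      refine mul_mem ⟨a⁻¹, map_inv₀ _ _⟩ (hXk _ ⟨a, rfl⟩)
    obtain ⟨m, b, hm, hb⟩ := exists_deriv_eq_of_new_constant hh hX hth
      (hXt.trans hr.symm)
    have hb' := hder b
    rw [hb, map_mul, map_natCast, hr] at hb'
    have hm0 : (m : L) ≠ 0 := by
      rw [← map_natCast (algebraMap k L), ne_eq, map_eq_zero]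
      exact_mod_cast hm.ne'
    -- The same alternative for `db - m dR/R`, with the constant `b - m t`.
    by_cases hdb : ∀ i, D i (algebraMap k L b) = m * (R⁻¹ * D i R)
    · have hc : ∀ i, D i (algebraMap k L b - m * t) = 0 := by
        intro i
        rw [map_sub, Derivation.leibniz, Derivation.map_natCast, hdb i, ht i]
        simp
      obtain ⟨c, hc⟩ := hconst _ hc
      have htm : t = (algebraMap k L b - algebraMap F L c) * (m : L)⁻¹ := by
        rw [hc]
        field_simp
        ring
      apply htr
      rw [htm, IsScalarTower.algebraMap_apply F k L, ← map_natCast (algebraMap k L), ← map_inv₀,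
        ← map_sub, ← map_mul]
      exact isAlgebraic_algebraMap _
    · push Not at hdb
      obtain ⟨i, hi⟩ := hdb
      refine hno (HasRelation.of_single (u := R) (v := algebraMap k L b) (-m) hR hR0
        ⟨b, rfl⟩ ?_ (i := i) ?_)
      · rw [← hb', map_neg, map_natCast]
        ring
      · rw [map_neg, map_natCast]
        intro h0
        apply hi
        linear_combination h0

/-- Descent of a logarithmic form killed by `X = ∑ sᵢ Dᵢ` through a transcendental exponential or
logarithm `t` over an algebraically closed subfield `k`. -/
theorem HasRelation.descend_of_transcendental [CharZero F] {D : Fin n → Derivation ℤ L L} {s : Fin n → L}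
    (hs : ∀ i, s i ∈ (algebraMap k L).range)
    (hD : ∀ i a, ∃ b, D i (algebraMap k L a) = algebraMap k L b)
    (hF : ∀ i (c : F), D i (algebraMap F L c) = 0)
    (hconst : ∀ f, (∀ i, D i f = 0) → f ∈ (algebraMap F L).range)
    (hk : ∀ x : L, IsAlgebraic k x → x ∈ (algebraMap k L).range)
    {t R : L} (hR : R ∈ (algebraMap k L).range) (htr : Transcendental k t)
    (ht : (t ≠ 0 ∧ ∀ i, D i t = t * D i R) ∨ (R ≠ 0 ∧ ∀ i, D i t = R⁻¹ * D i R))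
    (h : HasRelation F D (∑ i, s i • D i) {x | IsAlgebraic k⟮t⟯ x}) :
    HasRelation F D (∑ i, s i • D i) (algebraMap k L).range := by
  by_contra hno
  have hD' : ∀ i, ∀ x ∈ (algebraMap k L).range, D i x ∈ (algebraMap k L).range := by
    rintro i _ ⟨a, rfl⟩
    obtain ⟨b, hb⟩ := hD i a
    exact ⟨b, hb.symm⟩
  -- An `X`-constant `x` of this kind lies in `k`; if some `D i x` were nonzero, `dx` would itself
  -- be a relation over `k`.
  have hconstX : ∀ x, IsAlgebraic k⟮t⟯ x → (∑ i, s i • D i) x = 0 → ∃ c : F, x = algebraMap F L c := by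
    intro x hx hXx
    have hxk := hk x (isAlgebraic_new_constant hs hD hconst hR htr ht hno hx hXx)
    obtain ⟨c, hc⟩ := hconst x (fun i => by
      by_contra hi
      exact hno (HasRelation.of_apply_eq_zero hxk hXx hi))
    exact ⟨c, hc.symm⟩
  set X := ∑ i, s i • D i with hX_def
  have hXa : ∀ x, X x = ∑ i, s i * D i x := Derivation.sum_smul_apply D s
  have hXk : ∀ x ∈ (algebraMap k L).range, X x ∈ (algebraMap k L).range := by
    intro x hx
    rw [hXa]
    exact sum_mem fun i _ => mul_mem (hs i) (hD' i x hx)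
  have hXF : ∀ c : F, X (algebraMap F L c) = 0 := by
    intro c
    rw [hXa]
    exact Finset.sum_eq_zero fun i _ => by rw [hF, mul_zero]
  have hXk' : ∀ a, ∃ b, X (algebraMap k L a) = algebraMap k L b := fun a => by
    obtain ⟨b, hb⟩ := hXk _ ⟨a, rfl⟩
    exact ⟨b, hb.symm⟩
  obtain ⟨M, c, u, v, hu0, hu, hv, hX0, i₀, hi₀⟩ := h
  have halg : IsAlgebraic k⟮t⟯ t := isAlgebraic_algebraMap (AdjoinSimple.gen k t)
  have hcF : ∀ a : F, IsAlgebraic k⟮t⟯ (algebraMap F L a) := by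
    intro a
    rw [IsScalarTower.algebraMap_apply F k L, IsScalarTower.algebraMap_apply k k⟮t⟯ L]
    exact isAlgebraic_algebraMap _
  -- the value of the form on a suitable `k`-derivation commuting with `X` is a constant
  have main : ∀ δ : Derivation k L L, δ t ∈ k⟮t⟯ → X (δ t) = δ (X t) →
      ∃ γ : F, logSum (δ.restrictScalars ℤ) (algebraMap F L ∘ c) u v = algebraMap F L γ := by
    intro δ hδt hcomm
    refine hconstX _ (isAlgebraic_logSum δ hδt (fun j => hcF _) hu hv) ?_
    have hc' : ∀ x, IsAlgebraic k⟮t⟯ x → X ((δ.restrictScalars ℤ) x) = (δ.restrictScalars ℤ) (X x) :=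
      fun x hx => X.commute_of_isAlgebraic_adjoin hXk' δ hcomm hx
    have hδc : ∀ j, (δ.restrictScalars ℤ) ((algebraMap F L ∘ c) j) = 0 := by
      intro j
      change δ (algebraMap F L (c j)) = 0
      rw [IsScalarTower.algebraMap_apply F k L, δ.map_algebraMap]
    rw [logSum_comm (c := algebraMap F L ∘ c) hu0 (fun j => hXF (c j)) hδc (fun j => hc' _ (hu j))
      (hc' _ hv), hX0, map_zero]
  obtain ⟨δ, hδ⟩ := htr.exists_derivation_eq_one
  -- a form over `k` equal to the given one on all derivations in question suffices
  have finish : ∀ (M' : ℕ) (c' : Fin M' → F) (u' : Fin M' → L) (v' : L), (∀ j, u' j ≠ 0) →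
      (∀ j, u' j ∈ (algebraMap k L).range) → v' ∈ (algebraMap k L).range →
      (∀ i, logSum (D i) (algebraMap F L ∘ c') u' v' = logSum (D i) (algebraMap F L ∘ c) u v) →
      False := by
    intro M' c' u' v' h0 h1 h2 h3
    refine hno ⟨M', c', u', v', h0, h1, h2, ?_, i₀, by rwa [h3]⟩
    rw [← hX0, hX_def, logSum_sum_smul, logSum_sum_smul]
    exact Finset.sum_congr rfl fun i _ => by rw [h3]
  rcases ht with ⟨ht0, ht⟩ | ⟨hR0, ht⟩
  · have hXt : X t = X R * t := by
      rw [hXa, hXa, Finset.sum_mul]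
      exact Finset.sum_congr rfl fun i _ => by rw [ht]; ring
    have hδt : (t • δ) t = t := by
      change t * δ t = t
      rw [hδ, mul_one]
    -- `t d/dt` commutes with `X` because `X t = (X R) t` with `X R ∈ k`.
    obtain ⟨γ, hγ⟩ := main (t • δ) (hδt.symm ▸ mem_adjoin_simple_self k t) (by
      rw [hδt, hXt]
      obtain ⟨r, hr⟩ := hXk R hR
      rw [← hr, Derivation.leibniz, hδt, Derivation.map_algebraMap, smul_zero, add_zero]
      rfl)
    -- The prepended term `-γ dt/t` makes the form vanish on `t d/dt`. Below it is compensated by `γ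
    -- dR`, which equals `γ dt/t` and lives over `k`.
    obtain ⟨hvk, m, b, w, hw0, hw, hlog⟩ := exists_logSum_eq_of_logSum_eq_zero hk (t • δ) htr
      (by rwa [hδt]) (Fin.cons (-γ) c : Fin (M + 1) → F)
      (u := (Fin.cons t u : Fin (M + 1) → L)) (v := v)
      (Fin.cases ht0 hu0) (Fin.cases halg hu) hv (by
        rw [Fin.comp_cons, logSum_cons, hγ]
        change _ * (_ * (t • δ) t) + _ = 0
        rw [hδt, inv_mul_cancel₀ ht0, map_neg]
        ring)
    refine finish m b w (v + algebraMap F L γ * R) hw0 hw (add_mem hvk (mul_mem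
      ⟨algebraMap F k γ, (IsScalarTower.algebraMap_apply F k L γ).symm⟩ hR)) fun i => ?_
    have h1 := hlog (D i) v
    rw [Fin.comp_cons, logSum_cons] at h1
    rw [logSum_add_right, ← h1, Derivation.leibniz, hF, ht i, map_neg]
    simp only [smul_eq_mul]
    field_simp
    ring
  · have hXt : X t = R⁻¹ * X R := by
      rw [hXa, hXa, Finset.mul_sum]
      exact Finset.sum_congr rfl fun i _ => by rw [ht]; ring
    -- `d/dt` commutes with `X` because `X t = X R / R` lies in `k`.
    obtain ⟨γ, hγ⟩ := main δ (by rw [hδ]; exact one_mem _) (by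
      obtain ⟨a, ha⟩ := hR
      obtain ⟨r, hr⟩ := hXk _ ⟨a, rfl⟩
      rw [hδ, hXt, ← ha, ← hr, ← map_inv₀, ← map_mul, Derivation.map_algebraMap,
        Derivation.map_one_eq_zero])
    have hFt : ∀ d : Derivation ℤ L L, d (algebraMap F L γ) = 0 →
        d (v + -(algebraMap F L γ * t)) = d v - algebraMap F L γ * d t := by
      intro d hd
      rw [map_add, map_neg, Derivation.leibniz, hd]
      simp only [smul_eq_mul]
      ring
    obtain ⟨hvk, m, b, w, hw0, hw, hlog⟩ := exists_logSum_eq_of_logSum_eq_zero hk δ htr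
      (by rw [hδ]; exact one_ne_zero) c (v := v + -(algebraMap F L γ * t)) hu0 hu
      (hv.add ((hcF γ).mul halg).neg) (by
        rw [logSum_add_right, hγ]
        change _ + δ _ = 0
        rw [map_neg, Derivation.leibniz, hδ, IsScalarTower.algebraMap_apply F k L,
          δ.map_algebraMap]
        simp)
    -- The subtracted `γ dt` is restored as the logarithmic term `γ dR/R`.
    refine finish (m + 1) (Fin.cons γ b) (Fin.cons R w) (v + -(algebraMap F L γ * t))
      (Fin.cases hR0 hw0) (Fin.cases hR hw) hvk fun i => ?_
    rw [Fin.comp_cons, logSum_cons, ← hlog, logSum_add_right, map_neg, Derivation.leibniz, hF, ht]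
    simp only [smul_eq_mul]
    ring

end Descend

/-! ### Descent along the tower -/

section Tower

open IntermediateField

/-- Serves to compare subfields of `L` through their images alone, as they occur below over
different base fields. -/
theorem IsAlgebraic.of_range_le {A B L : Type*} [Field A] [Field B] [Field L] [Algebra A L]
    [Algebra B L] (h : ∀ a, algebraMap A L a ∈ (algebraMap B L).range) {x : L}
    (hx : IsAlgebraic A x) : IsAlgebraic B x := by
  choose f hf using h
  have hinj := (algebraMap B L).injective
  let g : A →+* B :=
    { toFun := f
      map_one' := hinj (by simp [hf])
      map_mul' := fun a b => hinj (by simp [hf])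
      map_zero' := hinj (by simp [hf])
      map_add' := fun a b => hinj (by simp [hf]) }
  obtain ⟨p, hp, hpx⟩ := hx
  refine ⟨p.map g, (Polynomial.map_ne_zero_iff g.injective).2 hp, ?_⟩
  rw [Polynomial.aeval_def, Polynomial.eval₂_map, ← hpx, Polynomial.aeval_def]
  congr 1
  exact RingHom.ext hf

variable {n : ℕ} {L : Type*} [Field L] [Algebra (RatFunField n) L]

/-- The algebraic closure in `L` of a subfield, as an extension of the ground field. -/
def relClosure {K L : Type*} [Field K] [Field L] [Algebra K L] (E : IntermediateField K L) :
    IntermediateField K L :=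
  (algebraicClosure E L).restrictScalars K

theorem mem_relClosure {K L : Type*} [Field K] [Field L] [Algebra K L]
    {E : IntermediateField K L} {x : L} : x ∈ relClosure E ↔ IsAlgebraic E x :=
  mem_algebraicClosure_iff

theorem mem_relClosure_of_isAlgebraic {K L : Type*} [Field K] [Field L] [Algebra K L]
    {E : IntermediateField K L} {x : L} (hx : IsAlgebraic (relClosure E) x) :
    x ∈ relClosure E := by
  have hx' : IsAlgebraic (algebraicClosure E L) x :=
    hx.of_range_le fun a => ⟨⟨a, a.2⟩, rfl⟩
  exact mem_relClosure.2 (hx'.restrictScalars E)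

theorem le_relClosure {K L : Type*} [Field K] [Field L] [Algebra K L]
    (E : IntermediateField K L) : E ≤ relClosure E := fun x hx =>
  mem_relClosure.2 (isAlgebraic_algebraMap (⟨x, hx⟩ : E))

theorem relClosure_stable {K L : Type*} [Field K] [Field L] [Algebra K L] [CharZero K]
    {E : IntermediateField K L} {d : Derivation ℤ L L}
    (h : ∀ x ∈ E, d x ∈ E) {x : L} (hx : x ∈ relClosure E) : d x ∈ relClosure E := by
  rw [mem_relClosure] at hx ⊢
  exact d.isAlgebraic_apply (fun a => ⟨⟨d a, h a a.2⟩, rfl⟩) hx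

theorem le_relClosure_of_finiteDimensional {K L : Type*} [Field K] [Field L] [Algebra K L]
    {E E' : IntermediateField K L} (h : E ≤ E') (_ : FiniteDimensional E (extendScalars h)) :
    E' ≤ relClosure E := by
  intro x hx
  rw [mem_relClosure]
  have h1 : IsAlgebraic E (⟨x, hx⟩ : extendScalars h) := Algebra.IsAlgebraic.isAlgebraic _
  exact h1.algebraMap (A := L)

theorem IsElementaryStep.stable {D : Fin n → Derivation ℤ L L}
    {E E' : IntermediateField (RatFunField n) L} (hstep : IsElementaryStep D E E')
    (hE : ∀ i, ∀ x ∈ E, D i x ∈ E) : ∀ i, ∀ x ∈ E', D i x ∈ E' := by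
  intro i x hx
  have adj : ∀ t : L, D i t ∈ E⟮t⟯ → x ∈ E⟮t⟯ → D i x ∈ E⟮t⟯ := by
    intro t ht hxt
    refine Derivation.apply_mem_adjoin (D i) (fun a => ?_) ?_ hxt
    · exact IntermediateField.algebraMap_mem _ (⟨D i a, hE i a a.2⟩ : E)
    · rintro _ rfl
      exact ht
  have hEt : ∀ t y : L, y ∈ E → y ∈ E⟮t⟯ := fun t y hy =>
    IntermediateField.algebraMap_mem _ (⟨y, hy⟩ : E)
  rcases hstep with ⟨t, R, ht0, hR, ht, rfl⟩ | ⟨t, R, hR0, hR, ht, rfl⟩ | ⟨hle, hfin⟩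
  · refine adj t ?_ hx
    have h1 : t⁻¹ * D i t = D i R := congrFun ht i
    rw [← mul_inv_cancel_left₀ ht0 (D i t), h1]
    exact mul_mem (mem_adjoin_simple_self E t) (hEt t _ (hE i R hR))
  · refine adj t ?_ hx
    have h1 : D i t = R⁻¹ * D i R := congrFun ht i
    rw [h1]
    exact mul_mem (inv_mem (hEt t _ hR)) (hEt t _ (hE i R hR))
  · have hsub := le_relClosure_of_finiteDimensional hle hfin
    have hx' : IsAlgebraic E x := mem_relClosure.1 (hsub hx)
    let _ : Differential L := ⟨D i⟩
    obtain ⟨_, _⟩ := Differential.exists_of_forall_exists (A := E) (L := L)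
      (fun a => ⟨⟨D i a, hE i a a.2⟩, rfl⟩)
    -- The finite extension carries its own extension of the derivation of `E`; by uniqueness on
    -- algebraic elements it agrees with `D i`.
    have h2 : D i x = ((Differential.deriv (⟨x, hx⟩ : extendScalars hle) : extendScalars hle) : L) :=
      (Differential.algHom_deriv' (extendScalars hle).val (extendScalars hle).val.injective
        (⟨x, hx⟩ : extendScalars hle)).symm
    rw [h2]
    exact Subtype.property (p := fun y => y ∈ extendScalars hle) _

theorem RatFunField.algebraMap_stable {D : Fin n → Derivation ℤ L L}
    (hL : IsDifferentialExtension D) :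
    ∀ i, ∀ x ∈ (⊥ : IntermediateField (RatFunField n) L), D i x ∈
      (⊥ : IntermediateField (RatFunField n) L) := by
  intro i x hx
  obtain ⟨a, rfl⟩ := mem_bot.1 hx
  rw [hL.restrict]
  exact IntermediateField.algebraMap_mem _ _

theorem HasRelation.descend {D : Fin n → Derivation ℤ L L} [Algebra ℂ L]
    [IsScalarTower ℂ (RatFunField n) L] {s : Fin n → RatFunField n}
    (hF : ∀ i (c : ℂ), D i (algebraMap ℂ L c) = 0)
    (hconst : ∀ f, (∀ i, D i f = 0) → f ∈ (algebraMap ℂ L).range)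
    {E E' : IntermediateField (RatFunField n) L} (hE : ∀ i, ∀ x ∈ E, D i x ∈ E)
    (hstep : IsElementaryStep D E E')
    (h : HasRelation ℂ D (∑ i, algebraMap (RatFunField n) L (s i) • D i) (relClosure E')) :
    HasRelation ℂ D (∑ i, algebraMap (RatFunField n) L (s i) • D i) (relClosure E) := by
  have hrange : ((algebraMap (relClosure E) L).range : Set L) = relClosure E := by
    ext x
    exact ⟨by rintro ⟨a, rfl⟩; exact a.2, fun hx => ⟨⟨x, hx⟩, rfl⟩⟩
  have adj : ∀ t R : L, R ∈ E →
      ((t ≠ 0 ∧ ∀ i, D i t = t * D i R) ∨ (R ≠ 0 ∧ ∀ i, D i t = R⁻¹ * D i R)) →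
      E' = E⟮t⟯.restrictScalars (RatFunField n) →
      HasRelation ℂ D (∑ i, algebraMap (RatFunField n) L (s i) • D i) (relClosure E) := by
    rintro t R hR ht rfl
    have hle : ∀ a : L, a ∈ E⟮t⟯ → a ∈ (relClosure E)⟮t⟯ := by
      intro a ha
      induction ha using adjoin_induction with
      | mem x hx => exact subset_adjoin _ _ hx
      | algebraMap x =>
        exact IntermediateField.algebraMap_mem _ (⟨x, le_relClosure E x.2⟩ : relClosure E)
      | add x y _ _ h h' => exact add_mem h h'
      | inv x _ h => exact inv_mem h
      | mul x y _ _ h h' => exact mul_mem h h'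
    have hsub : (relClosure (E⟮t⟯.restrictScalars (RatFunField n)) : Set L) ⊆
        {x | IsAlgebraic (relClosure E)⟮t⟯ x} := fun x hx =>
      (mem_relClosure.1 hx).of_range_le fun a => ⟨⟨a, hle a a.2⟩, rfl⟩
    replace h := h.mono hsub
    -- An algebraic `t` already lies in `relClosure E`, and nothing has to be done.
    by_cases htr : IsAlgebraic (relClosure E) t
    · refine h.mono fun x hx => mem_relClosure_of_isAlgebraic (IsAlgebraic.of_range_le
        (A := (relClosure E)⟮t⟯) (fun a => ?_) hx)
      have htE : t ∈ relClosure E := mem_relClosure_of_isAlgebraic htr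
      have hbot : (relClosure E)⟮t⟯ = ⊥ := adjoin_simple_eq_bot_iff.2 (mem_bot.2 ⟨⟨t, htE⟩, rfl⟩)
      obtain ⟨b, hb⟩ := mem_bot.1 (hbot.le a.2)
      exact ⟨b, hb⟩
    · have _ : IsScalarTower ℂ (relClosure E) L := IsScalarTower.of_algebraMap_eq fun _ => rfl
      rw [← hrange]
      exact HasRelation.descend_of_transcendental (k := relClosure E)
        (fun i => ⟨algebraMap _ _ (s i), rfl⟩)
        (fun i a => ⟨⟨D i a, relClosure_stable (hE i) a.2⟩, rfl⟩) hF hconst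
        (fun x hx => ⟨⟨x, mem_relClosure_of_isAlgebraic hx⟩, rfl⟩)
        ⟨⟨R, le_relClosure E hR⟩, rfl⟩ htr ht h
  rcases hstep with ⟨t, R, ht0, hR, ht, hE'⟩ | ⟨t, R, hR0, hR, ht, hE'⟩ | ⟨hle, hfin⟩
  · refine adj t R hR (Or.inl ⟨ht0, fun i => ?_⟩) hE'
    have h1 : t⁻¹ * D i t = D i R := congrFun ht i
    rw [← h1, mul_inv_cancel_left₀ ht0]
  · exact adj t R hR (Or.inr ⟨hR0, fun i => congrFun ht i⟩) hE'
  · have hsub := le_relClosure_of_finiteDimensional hle hfin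
    exact h.mono fun x hx => mem_relClosure_of_isAlgebraic
      ((mem_relClosure.1 hx).of_range_le fun a => ⟨⟨a, hsub a.2⟩, rfl⟩)

theorem logForm_apply (D : Fin n → Derivation ℤ L L) [Algebra ℂ L]
    [IsScalarTower ℂ (RatFunField n) L] {M : ℕ} (c : Fin M → ℂ) (u : Fin M → L) (v : L)
    (i : Fin n) : logForm D c u v i = logSum (D i) (algebraMap ℂ L ∘ c) u v := by
  simp [logForm, logSum, dform, Algebra.smul_def,
    IsScalarTower.algebraMap_apply ℂ (RatFunField n) L]

end Tower

theorem theorem4p1 (n : ℕ) (P : Fin n → RatFunField n)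
    (L : Type*) [Field L] [Algebra (RatFunField n) L]
    (D : Fin n → Derivation ℤ L L) (hL : IsElementaryExtension D)
    (hrel : ∃ (M : ℕ) (c : Fin M → ℂ) (u : Fin M → L) (v : L), IsElementaryRelation D P c u v) :
    ∃ E : IntermediateField (RatFunField n) L,
      FiniteDimensional (RatFunField n) E ∧
      ∃ (M : ℕ) (c : Fin M → ℂ) (u : Fin M → L) (v : L),
        (∀ k, u k ∈ E) ∧ v ∈ E ∧ IsElementaryRelation D P c u v := by
  let _ : Algebra ℂ L := ((algebraMap (RatFunField n) L).comp (algebraMap ℂ _)).toAlgebra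
  have _ : IsScalarTower ℂ (RatFunField n) L := IsScalarTower.of_algebraMap_eq fun _ => rfl
  obtain ⟨s, hs⟩ := exists_contraction (L := L) P
  have hF : ∀ i (c : ℂ), D i (algebraMap ℂ L c) = 0 := by
    intro i c
    rw [IsScalarTower.algebraMap_apply ℂ (RatFunField n) L, hL.restrict, Derivation.map_algebraMap,
      map_zero]
  have hconst : ∀ f, (∀ i, D i f = 0) → f ∈ (algebraMap ℂ L).range := by
    intro f hf
    have h1 : f ∈ diffConstants D := hf
    rw [hL.constants_eq] at h1
    obtain ⟨a, ha, rfl⟩ := h1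
    obtain ⟨c, rfl⟩ := RatFunField.mem_range_of_partialDeriv_eq_zero ha
    exact ⟨c, rfl⟩
  have hiff : ∀ {M : ℕ} (c : Fin M → ℂ) (u : Fin M → L) (v : L), IsElementaryRelation D P c u v ↔
      (∀ k, u k ≠ 0) ∧ logSum (∑ i, algebraMap (RatFunField n) L (s i) • D i)
        (algebraMap ℂ L ∘ c) u v = 0 ∧ ∃ i, logSum (D i) (algebraMap ℂ L ∘ c) u v ≠ 0 := by
    intro M c u v
    rw [IsElementaryRelation, hs, logSum_sum_smul, Function.ne_iff]
    simp only [logForm_apply, Pi.zero_apply]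
  have hdesc : ∀ E, Relation.ReflTransGen (IsElementaryStep D) ⊥ E →
      (∀ i, ∀ x ∈ E, D i x ∈ E) ∧
      (HasRelation ℂ D (∑ i, algebraMap (RatFunField n) L (s i) • D i) (relClosure E) →
        HasRelation ℂ D (∑ i, algebraMap (RatFunField n) L (s i) • D i)
          (relClosure (⊥ : IntermediateField (RatFunField n) L))) := by
    intro E hE
    induction hE with
    | refl => exact ⟨RatFunField.algebraMap_stable hL.toIsDifferentialExtension, id⟩
    | tail _ hstep ih =>
      exact ⟨hstep.stable ih.1, fun h => ih.2 (h.descend hF hconst ih.1 hstep)⟩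
  obtain ⟨M, c, u, v, hrel⟩ := hrel
  rw [hiff] at hrel
  obtain ⟨M', c', u', v', hu0, hu, hv, h0, h1⟩ := (hdesc ⊤ hL.tower).2
    ⟨M, c, u, v, hrel.1, fun j => le_relClosure _ IntermediateField.mem_top,
      le_relClosure _ IntermediateField.mem_top, hrel.2⟩
  have hint : ∀ x ∈ relClosure (⊥ : IntermediateField (RatFunField n) L),
      IsIntegral (RatFunField n) x := fun x hx =>
    (IsAlgebraic.of_range_le (B := RatFunField n) (fun a =>
      IntermediateField.mem_bot.1 a.2) (mem_relClosure.1 hx)).isIntegral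
  -- The closure of `K` in `L` may be infinite over `K`, but a relation involves only finitely many
  -- of its elements.
  refine ⟨IntermediateField.adjoin (RatFunField n) (Set.range u' ∪ {v'}),
    IntermediateField.finiteDimensional_adjoin ?_, M', c', u', v',
    fun j => IntermediateField.subset_adjoin _ _ (Or.inl ⟨j, rfl⟩),
    IntermediateField.subset_adjoin _ _ (Or.inr rfl), (hiff _ _ _).2 ⟨hu0, h0, h1⟩⟩
  rintro x (⟨j, rfl⟩ | rfl)
  · exact hint _ (hu j)
  · exact hint _ hv
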